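/- For a function $g$ on $\mathbb{K}=\mathbb{R}$ or $\mathbb{K}=\mathbb{Z}$ let $\operatorname{Var}(g)=\sup \sum_{i=1}^{m}|g(x_i)-g(x_{i-1})|$, the supremum being over all finite sequences $x_0\le x_1\le\dots\le x_m$ in $\mathbb{K}$, denote its total variation. Let $M$ denote the centered Hardy--Littlewood maximal operator, that is, \[ Mg(x)=\sup_{r>0}\frac1{2r}\int_{x-r}^{x+r}|g|\quad(x\in\mathbb{R}),\qquad MG(n)=\sup_{m\ge 0}\frac1{2m+1}\sum_{y=n-m}^{n+m}|G(y)|\quad(n\in\mathbb{Z}) \] for locally integrable $g\colon\mathbb{R}\to\mathbb{C}$ and for $G\colon\mathbb{Z}\to\mathbb{C}$, where $m$ ranges over the nonnegative integers. Let $K\ge1$ be an integer, let $a,b\in\mathbb{C}$, and let $\alpha_1,\dots,\alpha_K\in\mathbb{C}$ satisfy $\alpha_k\alpha_{k+1}=0$ for $1\le k\le K-1$. (i) Let $A=t_0<t_1<\dots<t_K=B$ be real numbers and define $f\colon\mathbb{R}\to\mathbb{C}$ by \[ f=a\,\mathbf 1_{(-\infty,A)}+\sum_{k=1}^K\alpha_k\mathbf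 1_{[t_{k-1},t_k)}+b\,\mathbf 1_{[B,\infty)}. \] Then $f$ and $Mf$ have finite total variation and \[ \operatorname{Var}(Mf)\le\operatorname{Var}(f)-\tfrac12\bigl||a|-|b|\bigr|. \] (ii) Let $A=n_0<n_1<\dots<n_K=B$ be integers and define $F\colon\mathbb{Z}\to\mathbb{C}$ by \[ F=a\,\mathbf 1_{(-\infty,A)}+\sum_{k=1}^K\alpha_k\mathbf 1_{[n_{k-1},n_k)}+b\,\mathbf 1_{[B,\infty)}. \] Then $F$ and $MF$ have finite total variation and \[ \operatorname{Var}(MF)\le\operatorname{Var}(F)-\tfrac12\bigl||a|-|b|\bigr|. \] -/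

import Mathlib

noncomputable section

/-- The centered Hardy–Littlewood maximal function
`Mg(x) = sup_{r > 0} (1 / 2r) ∫_{x-r}^{x+r} |g|` on `ℝ`. For bounded measurable `g`
the averages are bounded by `sup |g|`, so the real-valued supremum is the genuine one. -/
def centeredMaximal (g : ℝ → ℂ) (x : ℝ) : ℝ :=
  ⨆ r : Set.Ioi (0 : ℝ), (1 / (2 * (r : ℝ))) * ∫ y in (x - (r : ℝ))..(x + (r : ℝ)), ‖g y‖

/-- The discrete centered Hardy–Littlewood maximal function
`MG(n) = sup_{m ≥ 0} (1 / (2m+1)) ∑_{y=n-m}^{n+m} |G(y)|` on `ℤ`. -/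
def discreteCenteredMaximal (G : ℤ → ℂ) (n : ℤ) : ℝ :=
  ⨆ m : ℕ, (1 / (2 * (m : ℝ) + 1)) * ∑ y ∈ Finset.Icc (n - (m : ℤ)) (n + (m : ℤ)), ‖G y‖

/-- The function `a 1_{(-∞, t_0)} + ∑_{k=1}^K α_k 1_{[t_{k-1}, t_k)} + b 1_{[t_K, ∞)}`.
The coefficient `α_k`, `1 ≤ k ≤ K`, is the value of `α` at the element `k - 1` of `Fin K`. -/
def stepFunction {𝕂 : Type*} [LinearOrder 𝕂] {K : ℕ} (a b : ℂ) (α : Fin K → ℂ)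
    (t : Fin (K + 1) → 𝕂) (x : 𝕂) : ℂ :=
  (Set.Iio (t 0)).indicator (fun _ => a) x
    + ∑ k : Fin K, (Set.Ico (t k.castSucc) (t k.succ)).indicator (fun _ => α k) x
    + (Set.Ici (t (Fin.last K))).indicator (fun _ => b) x

/-- The total variation of `g` as a real number (meaningful when `g` has bounded variation). -/
def totalVariation {𝕂 E : Type*} [LinearOrder 𝕂] [PseudoEMetricSpace E] (g : 𝕂 → E) : ℝ :=
  (eVariationOn g Set.univ).toReal

end

/-! Only the heights of |f| matter: `h 0` = |a|, the |α_k|, and `h (K + 1)` = |b|. Finitely many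
weighted levels write each relevant number q as the total weight of the levels ≤ q, so the problem
can be treated level by level. By the separation hypothesis the bounded cells that reach a positive
level are never adjacent, so |f| crosses that level twice per high cell, up to corrections at the
two ends.

The variation of Mf is charged to a potential. Where Mf is below a level, the potential counts 2 for
each high cell already passed; where Mf reaches the level, it interpolates between odd numbers by
ramps. The weighted sum over the levels is at most |a| plus the sum of the jumps of |f|
(`levelPot_le`, `potential_le`). When Mf rises from x to y and falls to x', this sum grows by at
least 2Mf(y) - Mf(x) - Mf(x') (`potential_step`).

For the growth, take an interval between break points with centre strictly between x and x' and
maximal average p ≥ Mf(y). Its two end cells have height at least p (`exists_best_interval`). If the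
centre lies in an end cell, every level gains what it should. Otherwise a level between Mf(x) and p
may fall short, because its current ramp is unfinished at the centre. The interval about x with the
same right end has average at most Mf(x), which bounds the missing part of the ramp by the distance
travelled from x. Over that distance every level up to Mf(x) grows at least as fast as the ramp
(`upperPot_growth`), and `sum_levels_nonneg` balances gains against losses. The descent is the
mirror image.

By reflection |a| ≤ |b|. Everywhere Mf ≥ c = (|a| + |b|)/2, and Mf tends to c at -∞, so the
potential starts at c while its bound contains only |a|. The difference c - |a| is the improvement
in the theorem. The discrete maximal function is the restriction to ℤ of the continuous one of a
step function on ℝ with the same heights. -/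

/-- A finite set of positive levels carries weights that turn each level `q` into the sum of the
weights of the levels `≤ q`. -/
theorem exists_level_weights (S : Finset ℝ) (hS : ∀ q ∈ S, 0 < q) :
    ∃ δ : ℝ → ℝ, (∀ q ∈ S, 0 ≤ δ q) ∧
      ∀ q, q ∈ S ∨ q = 0 → ∑ l ∈ S, (if l ≤ q then δ l else 0) = q := by
  induction S using Finset.induction_on_max with
  | empty => exact ⟨fun _ => 0, by simp, by simp⟩
  | insert M S hM ih =>
    obtain ⟨δ, h0, h1⟩ := ih fun q hq => hS q (Finset.mem_insert_of_mem hq)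
    have hMS : M ∉ S := fun h => lt_irrefl _ (hM M h)
    have hne : ∀ l ∈ S, l ≠ M := fun l hl => (hM l hl).ne
    have htot : ∑ l ∈ S, δ l ≤ M := by
      rcases S.eq_empty_or_nonempty with rfl | hne'
      · simpa using (hS M (by simp)).le
      · have h2 := h1 (S.max' hne') (Or.inl (S.max'_mem _))
        rw [Finset.sum_congr rfl (fun l hl => if_pos (S.le_max' l hl))] at h2
        rw [h2]
        exact (hM _ (S.max'_mem _)).le
    -- The earlier weights add up to the largest earlier level, or to 0; the new top level receives
    -- the remaining gap.
    refine ⟨fun l => if l = M then M - ∑ l ∈ S, δ l else δ l, ?_, ?_⟩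
    · intro q hq
      rcases Finset.mem_insert.1 hq with rfl | hq
      · simpa using htot
      · simpa [hne q hq] using h0 q hq
    · intro q hq
      rw [Finset.sum_insert hMS]
      have hcongr : ∀ r, ∑ l ∈ S, (if l ≤ r then (if l = M then M - ∑ l ∈ S, δ l else δ l) else 0)
          = ∑ l ∈ S, (if l ≤ r then δ l else 0) := fun r =>
        Finset.sum_congr rfl fun l hl => by simp [hne l hl]
      rw [hcongr]
      by_cases hqM : q = M
      · subst hqM
        rw [Finset.sum_congr rfl (fun l hl => if_pos (hM l hl).le)]
        simp
      · have hq' : q ∈ S ∨ q = 0 := by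
          rcases hq with hq | hq
          · exact Or.inl ((Finset.mem_insert.1 hq).resolve_left hqM)
          · exact Or.inr hq
        have hlt : ¬ M ≤ q := by
          rcases hq' with hq' | rfl
          · exact not_le.2 (hM q hq')
          · exact not_le.2 (hS M (by simp))
        rw [if_neg hlt, zero_add, h1 q hq']

/-! ### The potential of a single level -/

noncomputable section

/-- The bounded cells of height at least `lam`. -/
def highCells (K : ℕ) (h : ℕ → ℝ) (lam : ℝ) : Finset ℕ :=
  (Finset.Icc 1 K).filter fun k => lam ≤ h k

/-- The last high cell before `l`, or `0` if there is none. -/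
def prevHigh (K : ℕ) (h : ℕ → ℝ) (lam : ℝ) (l : ℕ) : ℕ :=
  ((highCells K h lam).filter (· < l)).sup id

/-- The piecewise linear function rising from `0` at `p` to `1` at `q`. -/
def ramp (p q z : ℝ) : ℝ := max 0 (min 1 ((z - p) / (q - p)))

/-- The ramp from the left end of the high cell before `l` to the right end of `l`. -/
def rise (K : ℕ) (h t : ℕ → ℝ) (lam : ℝ) (l : ℕ) (z : ℝ) : ℝ :=
  if prevHigh K h lam l = 0 then 0 else ramp (t (prevHigh K h lam l - 1)) (t l) z

/-- The potential at level `lam` of a point where the maximal function is at least `lam`. -/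
def upperPot (K : ℕ) (h t : ℕ → ℝ) (lam z : ℝ) : ℝ :=
  1 + ∑ l ∈ highCells K h lam, 2 * rise K h t lam l z

/-- The potential at level `lam` of a point where the maximal function is below `lam`. -/
def lowerPot (K : ℕ) (h t : ℕ → ℝ) (lam x : ℝ) : ℝ :=
  2 * (((highCells K h lam).filter fun l => t l ≤ x).card : ℝ)

end

/-! ### Ramps and bounds for the potentials -/

section Combinatorics

variable {K : ℕ} {h t : ℕ → ℝ} {lam : ℝ}

theorem mem_highCells {k : ℕ} : k ∈ highCells K h lam ↔ (1 ≤ k ∧ k ≤ K) ∧ lam ≤ h k := by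
  simp [highCells]

theorem highCells_anti {lam' : ℝ} (hl : lam' ≤ lam) : highCells K h lam ⊆ highCells K h lam' := by
  intro k hk
  rw [mem_highCells] at hk ⊢
  exact ⟨hk.1, hl.trans hk.2⟩

theorem le_prevHigh {k l : ℕ} (hk : k ∈ highCells K h lam) (hkl : k < l) :
    k ≤ prevHigh K h lam l :=
  Finset.le_sup (f := id) (Finset.mem_filter.2 ⟨hk, hkl⟩)

theorem prevHigh_spec {l : ℕ} (hp : prevHigh K h lam l ≠ 0) :
    prevHigh K h lam l ∈ highCells K h lam ∧ prevHigh K h lam l < l := by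
  have hne : ((highCells K h lam).filter (· < l)).Nonempty := by
    rw [Finset.nonempty_iff_ne_empty]
    intro he
    exact hp (by simp [prevHigh, he])
  obtain ⟨k, hk, he⟩ := Finset.exists_mem_eq_sup _ hne id
  have he' : prevHigh K h lam l = k := he
  rw [he']
  exact Finset.mem_filter.1 hk

theorem prevHigh_eq {k l : ℕ} (hk : k ∈ highCells K h lam) (hkl : k < l)
    (hmax : ∀ k' ∈ highCells K h lam, k' < l → k' ≤ k) : prevHigh K h lam l = k := by
  have h1 := le_prevHigh hk hkl
  have h2 : prevHigh K h lam l ≠ 0 := by have := (mem_highCells.1 hk).1.1; omega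
  exact le_antisymm (hmax _ (prevHigh_spec h2).1 (prevHigh_spec h2).2) h1

theorem ramp_nonneg (p q z : ℝ) : 0 ≤ ramp p q z := le_max_left _ _

theorem ramp_le_one (p q z : ℝ) : ramp p q z ≤ 1 :=
  max_le zero_le_one (min_le_left _ _)

theorem ramp_mono {p q : ℝ} (hpq : p < q) : Monotone (ramp p q) := by
  intro u v huv
  have : 0 < q - p := sub_pos.2 hpq
  unfold ramp
  gcongr

theorem ramp_eq_one {p q z : ℝ} (hpq : p < q) (hz : q ≤ z) : ramp p q z = 1 := by
  have h0 : 0 < q - p := sub_pos.2 hpq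
  have h1 : 1 ≤ (z - p) / (q - p) := by rw [le_div_iff₀ h0]; linarith
  simp [ramp, min_eq_left h1]

theorem ramp_eq_zero {p q z : ℝ} (hpq : p < q) (hz : z ≤ p) : ramp p q z = 0 := by
  have h0 : 0 < q - p := sub_pos.2 hpq
  have h1 : (z - p) / (q - p) ≤ 0 := div_nonpos_of_nonpos_of_nonneg (by linarith) h0.le
  unfold ramp
  exact max_eq_left ((min_le_right _ _).trans h1)

theorem ramp_mul {p q : ℝ} (hpq : p < q) (z : ℝ) :
    ramp p q z * (q - p) = max p (min q z) - p := by
  have h0 : 0 < q - p := sub_pos.2 hpq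
  rcases le_total z p with hz | hz
  · rw [ramp_eq_zero hpq hz, min_eq_right (hz.trans hpq.le), max_eq_left hz]; ring
  rcases le_total q z with hz' | hz'
  · rw [ramp_eq_one hpq hz', min_eq_left hz', max_eq_right hpq.le]; ring
  have h1 : (z - p) / (q - p) ≤ 1 := by rw [div_le_one h0]; linarith
  have h2 : 0 ≤ (z - p) / (q - p) := div_nonneg (by linarith) h0.le
  rw [ramp, min_eq_right h1, max_eq_right h2, min_eq_right hz', max_eq_right hz]
  field_simp

theorem clip_add_clip {p q r z : ℝ} (hpq : p ≤ q) (hqr : q ≤ r) :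
    max p (min q z) + max q (min r z) = max p (min r z) + q := by
  rcases le_total z q with hz | hz
  · rw [min_eq_right hz, min_eq_right (hz.trans hqr), max_eq_left hz]
  · rw [min_eq_left hz, max_eq_right hpq]
    have : q ≤ min r z := le_min hqr hz
    rw [max_eq_right this, max_eq_right (hpq.trans this)]; ring

theorem clip_sub_le {p q r u v : ℝ} (hpq : p ≤ q) (huv : u ≤ v) :
    max q (min r v) - max q (min r u) ≤ max p (min r v) - max p (min r u) := by
  have h1 : min r u ≤ min r v := min_le_min_left _ huv
  generalize min r u = x at *
  generalize min r v = y at *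
  rcases le_total y q with hy | hy
  · rw [max_eq_left hy, max_eq_left (h1.trans hy)]
    have := max_le_max_left p h1
    linarith
  · rw [max_eq_right hy, max_eq_right (hpq.trans hy)]
    have := max_le_max_right x hpq
    linarith

theorem le_of_strict (ht : ∀ i j, i < j → j ≤ K → t i < t j) {i j : ℕ} (hij : i ≤ j)
    (hj : j ≤ K) : t i ≤ t j := by
  rcases hij.eq_or_lt with rfl | hlt
  · exact le_rfl
  · exact (ht i j hlt hj).le

theorem prevHigh_lt (ht : ∀ i j, i < j → j ≤ K → t i < t j) {l : ℕ}
    (hl : l ∈ highCells K h lam) (hp : prevHigh K h lam l ≠ 0) :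
    t (prevHigh K h lam l - 1) < t l := by
  have h1 := prevHigh_spec hp
  exact ht _ _ (by omega) (mem_highCells.1 hl).1.2

theorem rise_nonneg (l : ℕ) (z : ℝ) : 0 ≤ rise K h t lam l z := by
  unfold rise; split_ifs
  · exact le_rfl
  · exact ramp_nonneg _ _ _

theorem rise_le_one (l : ℕ) (z : ℝ) : rise K h t lam l z ≤ 1 := by
  unfold rise; split_ifs
  · exact zero_le_one
  · exact ramp_le_one _ _ _

theorem rise_mono (ht : ∀ i j, i < j → j ≤ K → t i < t j) {l : ℕ}
    (hl : l ∈ highCells K h lam) : Monotone (rise K h t lam l) := by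
  intro u v huv
  unfold rise; split_ifs with hp
  · exact le_rfl
  · exact ramp_mono (prevHigh_lt ht hl hp) huv

theorem rise_eq_one (ht : ∀ i j, i < j → j ≤ K → t i < t j) {l : ℕ}
    (hl : l ∈ highCells K h lam) (hp : prevHigh K h lam l ≠ 0) {z : ℝ} (hz : t l ≤ z) :
    rise K h t lam l z = 1 := by
  rw [rise, if_neg hp, ramp_eq_one (prevHigh_lt ht hl hp) hz]

theorem rise_eq_zero (ht : ∀ i j, i < j → j ≤ K → t i < t j) {l : ℕ}
    (hl : l ∈ highCells K h lam) {z : ℝ}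
    (hz : prevHigh K h lam l ≠ 0 → z ≤ t (prevHigh K h lam l - 1)) :
    rise K h t lam l z = 0 := by
  unfold rise; split_ifs with hp
  · rfl
  · exact ramp_eq_zero (prevHigh_lt ht hl hp) (hz hp)

theorem upperPot_mono (ht : ∀ i j, i < j → j ≤ K → t i < t j) :
    Monotone (upperPot K h t lam) := by
  intro u v huv
  unfold upperPot
  have := Finset.sum_le_sum fun l hl =>
    mul_le_mul_of_nonneg_left (rise_mono (h := h) (lam := lam) ht hl huv) (zero_le_two (α := ℝ))
  linarith

theorem one_le_upperPot (z : ℝ) : 1 ≤ upperPot K h t lam z := by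
  unfold upperPot
  have : 0 ≤ ∑ l ∈ highCells K h lam, 2 * rise K h t lam l z :=
    Finset.sum_nonneg fun l _ => mul_nonneg zero_le_two (rise_nonneg l z)
  linarith

theorem upperPot_eq_one (ht : ∀ i j, i < j → j ≤ K → t i < t j) {z : ℝ} (hz : z ≤ t 0) :
    upperPot K h t lam z = 1 := by
  unfold upperPot
  rw [Finset.sum_eq_zero, add_zero]
  intro l hl
  rw [rise_eq_zero ht hl, mul_zero]
  intro hp
  have h1 := prevHigh_spec hp
  have h2 := mem_highCells.1 hl
  exact hz.trans (le_of_strict ht (Nat.zero_le _) (by omega))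

theorem lowerPot_mono : Monotone (lowerPot K h t lam) := by
  intro u v huv
  unfold lowerPot
  have : ((highCells K h lam).filter fun l => t l ≤ u).card
      ≤ ((highCells K h lam).filter fun l => t l ≤ v).card :=
    Finset.card_le_card fun l hl => by
      rw [Finset.mem_filter] at hl ⊢
      exact ⟨hl.1, hl.2.trans huv⟩
  have : (((highCells K h lam).filter fun l => t l ≤ u).card : ℝ)
      ≤ ((highCells K h lam).filter fun l => t l ≤ v).card := by exact_mod_cast this
  linarith

/-- A sum of rises over a set of high cells that contains a high cell without predecessor. -/
theorem sum_rise_le {s : Finset ℕ} {k : ℕ} (hk : k ∈ s) (hp : prevHigh K h lam k = 0) (z : ℝ) :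
    ∑ l ∈ s, 2 * rise K h t lam l z ≤ 2 * (s.card : ℝ) - 2 := by
  rw [← Finset.add_sum_erase _ _ hk]
  have h0 : rise K h t lam k z = 0 := by simp [rise, hp]
  have h1 : ∑ l ∈ s.erase k, 2 * rise K h t lam l z ≤ ∑ _l ∈ s.erase k, (2 : ℝ) :=
    Finset.sum_le_sum fun l _ => by linarith [rise_le_one (K := K) (h := h) (t := t) (lam := lam) l z]
  rw [Finset.sum_const, nsmul_eq_mul, Finset.card_erase_of_mem hk,
    Nat.cast_sub (Finset.card_pos.2 ⟨k, hk⟩)] at h1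
  push_cast at h1
  linarith

/-- The first high cell has no ramp. Hence N high cells let the upper potential range from 1 to 2N -
1, between the values 0 and 2N of the lower one. -/
theorem exists_first_highCell (hne : (highCells K h lam).Nonempty) :
    ∃ k ∈ highCells K h lam, (∀ l ∈ highCells K h lam, k ≤ l) ∧ prevHigh K h lam k = 0 := by
  refine ⟨_, Finset.min'_mem _ hne, fun l hl => Finset.min'_le _ l hl, ?_⟩
  by_contra hp
  have h1 := prevHigh_spec hp
  exact absurd h1.2 (not_lt.2 (Finset.min'_le _ _ h1.1))

theorem upperPot_le (hne : (highCells K h lam).Nonempty) (z : ℝ) :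
    upperPot K h t lam z ≤ 2 * ((highCells K h lam).card : ℝ) - 1 := by
  obtain ⟨k, hk, -, hp⟩ := exists_first_highCell hne
  have := sum_rise_le (t := t) hk hp z
  unfold upperPot
  linarith

/-- Lower bound for the upper potential to the right of a point `x`. -/
theorem lowerPot_le_upperPot (ht : ∀ i j, i < j → j ≤ K → t i < t j) {x y : ℝ} (hxy : x ≤ y)
    (hex : ∃ j ∈ highCells K h lam, x < t j) :
    lowerPot K h t lam x + 1 ≤ upperPot K h t lam y ∨
    ∃ l ∈ highCells K h lam, prevHigh K h lam l ≠ 0 ∧ t (prevHigh K h lam l) ≤ x ∧ x < t l ∧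
      (∀ j ∈ highCells K h lam, x < t j → l ≤ j) ∧
      lowerPot K h t lam x + 1 ≤ upperPot K h t lam y + 2 * (1 - rise K h t lam l y) := by
  classical
  set L := (highCells K h lam).filter fun l => t l ≤ x with hL
  rcases L.eq_empty_or_nonempty with he | hne
  · left
    have : lowerPot K h t lam x = 0 := by simp [lowerPot, ← hL, he]
    rw [this]
    linarith [one_le_upperPot (K := K) (h := h) (t := t) (lam := lam) y]
  right
  set R := (highCells K h lam).filter fun l => x < t l with hR
  have hRne : R.Nonempty := by
    obtain ⟨j, hj, hxj⟩ := hex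
    exact ⟨j, Finset.mem_filter.2 ⟨hj, hxj⟩⟩
  obtain ⟨l, hlR, hlmin⟩ : ∃ l ∈ R, ∀ j ∈ R, l ≤ j :=
    ⟨_, R.min'_mem hRne, fun j hj => R.min'_le j hj⟩
  obtain ⟨k, hkL, hkmax⟩ : ∃ l ∈ L, ∀ j ∈ L, j ≤ l :=
    ⟨_, L.max'_mem hne, fun j hj => L.le_max' j hj⟩
  have hl := Finset.mem_filter.1 hlR
  have hk := Finset.mem_filter.1 hkL
  have hkl : k < l := by
    by_contra hcon
    have := le_of_strict ht (not_lt.1 hcon) (mem_highCells.1 hk.1).1.2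
    linarith [hl.2, hk.2]
  have hprev : prevHigh K h lam l = k := by
    refine prevHigh_eq hk.1 hkl fun k' hk' hlt => ?_
    by_cases hx : t k' ≤ x
    · exact hkmax _ (Finset.mem_filter.2 ⟨hk', hx⟩)
    · have := hlmin k' (Finset.mem_filter.2 ⟨hk', not_le.1 hx⟩)
      omega
  have hk0 : k ≠ 0 := by have := (mem_highCells.1 hk.1).1.1; omega
  refine ⟨l, hl.1, by rwa [hprev], by rw [hprev]; exact hk.2, hl.2,
    fun j hj hxj => hlmin j (Finset.mem_filter.2 ⟨hj, hxj⟩), ?_⟩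
  -- If n high cells end at or before x, the lower potential is 2n. At y the ramps of all of these
  -- except the first are complete, and l adds its partial ramp, so the upper potential is at least
  -- 2n - 1 plus twice that ramp.
  obtain ⟨k₀, hk₀, hmin, -⟩ := exists_first_highCell (K := K) (h := h) (lam := lam) ⟨k, hk.1⟩
  have hk₀L : k₀ ∈ L := Finset.mem_filter.2
    ⟨hk₀, (le_of_strict ht (hmin k hk.1) (mem_highCells.1 hk.1).1.2).trans hk.2⟩
  have hlL : l ∉ L.erase k₀ := fun hmem => by
    have := (Finset.mem_filter.1 (Finset.mem_of_mem_erase hmem)).2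
    linarith [hl.2]
  have hsub : insert l (L.erase k₀) ⊆ highCells K h lam := by
    intro j hj
    rcases Finset.mem_insert.1 hj with rfl | hj
    · exact hl.1
    · exact (Finset.mem_filter.1 (Finset.mem_of_mem_erase hj)).1
  have h1 := Finset.sum_le_sum_of_subset_of_nonneg hsub (f := fun j => 2 * rise K h t lam j y)
    fun j _ _ => mul_nonneg zero_le_two (rise_nonneg j y)
  rw [Finset.sum_insert hlL] at h1
  have h2 : ∑ j ∈ L.erase k₀, 2 * rise K h t lam j y = ∑ _j ∈ L.erase k₀, (2 : ℝ) := by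
    refine Finset.sum_congr rfl fun j hj => ?_
    have hj1 := Finset.mem_filter.1 (Finset.mem_of_mem_erase hj)
    have hj2 : k₀ < j := lt_of_le_of_ne (hmin j hj1.1) (Ne.symm (Finset.ne_of_mem_erase hj))
    have hj3 : prevHigh K h lam j ≠ 0 := by
      have := le_prevHigh hk₀ hj2
      have := (mem_highCells.1 hk₀).1.1
      omega
    rw [rise_eq_one ht hj1.1 hj3 (hj1.2.trans hxy), mul_one]
  rw [h2, Finset.sum_const, nsmul_eq_mul, Finset.card_erase_of_mem hk₀L,
    Nat.cast_sub (Finset.card_pos.2 hne)] at h1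
  have h3 : lowerPot K h t lam x = 2 * (L.card : ℝ) := rfl
  have h4 : upperPot K h t lam y = 1 + ∑ j ∈ highCells K h lam, 2 * rise K h t lam j y := rfl
  push_cast at h1
  linarith

/-- Upper bound for the upper potential to the left of a point `x`. -/
theorem upperPot_le_lowerPot (ht : ∀ i j, i < j → j ≤ K → t i < t j) {x y : ℝ} (hyx : y ≤ x)
    (hoff : ∀ k ∈ highCells K h lam, x ≤ t (k - 1) ∨ t k ≤ x)
    (hex : ∃ i ∈ highCells K h lam, t i ≤ x) :
    upperPot K h t lam y + 1 ≤ lowerPot K h t lam x ∨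
    ∃ l ∈ highCells K h lam, prevHigh K h lam l ≠ 0 ∧ t (prevHigh K h lam l) ≤ x ∧
      x ≤ t (l - 1) ∧ (∀ i ∈ highCells K h lam, t i ≤ x → i ≤ prevHigh K h lam l) ∧
      upperPot K h t lam y + 1 ≤ lowerPot K h t lam x + 2 * rise K h t lam l y := by
  classical
  set L := (highCells K h lam).filter fun l => t l ≤ x with hL
  set R := (highCells K h lam).filter fun l => ¬ t l ≤ x with hR
  have hne : L.Nonempty := by
    obtain ⟨j, hj, hxj⟩ := hex
    exact ⟨j, Finset.mem_filter.2 ⟨hj, hxj⟩⟩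
  have h4 : upperPot K h t lam y = 1 + (∑ j ∈ L, 2 * rise K h t lam j y
      + ∑ j ∈ R, 2 * rise K h t lam j y) := by
    rw [hL, hR, Finset.sum_filter_add_sum_filter_not]; rfl
  have h3 : lowerPot K h t lam x = 2 * (L.card : ℝ) := rfl
  obtain ⟨k, hkL, hkmax⟩ : ∃ l ∈ L, ∀ j ∈ L, j ≤ l :=
    ⟨_, L.max'_mem hne, fun j hj => L.le_max' j hj⟩
  have hk := Finset.mem_filter.1 hkL
  obtain ⟨k₀, hk₀, hmin, hpk₀⟩ := exists_first_highCell (K := K) (h := h) (lam := lam) ⟨k, hk.1⟩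
  have hk₀L : k₀ ∈ L := Finset.mem_filter.2
    ⟨hk₀, (le_of_strict ht (hmin k hk.1) (mem_highCells.1 hk.1).1.2).trans hk.2⟩
  have h5 := sum_rise_le (t := t) hk₀L hpk₀ y
  rcases R.eq_empty_or_nonempty with he | hRne
  · left
    rw [he, Finset.sum_empty] at h4
    linarith
  right
  obtain ⟨l, hlR, hlmin⟩ : ∃ l ∈ R, ∀ j ∈ R, l ≤ j :=
    ⟨_, R.min'_mem hRne, fun j hj => R.min'_le j hj⟩
  have hl := Finset.mem_filter.1 hlR
  have hkl : k < l := by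
    by_contra hcon
    have := le_of_strict ht (not_lt.1 hcon) (mem_highCells.1 hk.1).1.2
    exact hl.2 (this.trans hk.2)
  have hprev : prevHigh K h lam l = k := by
    refine prevHigh_eq hk.1 hkl fun k' hk' hlt => ?_
    by_cases hx : t k' ≤ x
    · exact hkmax _ (Finset.mem_filter.2 ⟨hk', hx⟩)
    · have := hlmin k' (Finset.mem_filter.2 ⟨hk', hx⟩)
      omega
  have hk0 : k ≠ 0 := by have := (mem_highCells.1 hk.1).1.1; omega
  have hxl : x ≤ t (l - 1) := (hoff l hl.1).resolve_right hl.2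
  refine ⟨l, hl.1, by rwa [hprev], by rw [hprev]; exact hk.2, hxl,
    fun i hi hix => by rw [hprev]; exact hkmax i (Finset.mem_filter.2 ⟨hi, hix⟩), ?_⟩
  -- The ramp of a high cell after l starts no earlier than the left end of l, which is at or beyond
  -- x because x is not inside a high cell.
  have h6 : ∑ j ∈ R, 2 * rise K h t lam j y = 2 * rise K h t lam l y := by
    refine Finset.sum_eq_single_of_mem l hlR fun j hj hjl => ?_
    have hj1 := Finset.mem_filter.1 hj
    have hj2 : l < j := lt_of_le_of_ne (hlmin j hj) (Ne.symm hjl)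
    rw [rise_eq_zero ht hj1.1, mul_zero]
    intro hp
    have h7 := le_prevHigh hl.1 hj2
    have h8 := prevHigh_spec hp
    have h9 := mem_highCells.1 hj1.1
    exact (hyx.trans hxl).trans (le_of_strict ht (by omega) (by omega))
  rw [h6] at h4
  linarith

/-- The left side is the length of the part of [u, v] inside [t (k - 1), t l]. The ramps of the high
cells after k up to l cover that interval and none is longer than it, so each has at least the slope
of a single ramp across it. The induction peels off the last ramp. -/
theorem clip_le_sum_rise (ht : ∀ i j, i < j → j ≤ K → t i < t j) {k : ℕ}
    (hk : k ∈ highCells K h lam) {u v : ℝ} (huv : u ≤ v) (l : ℕ) (hl : l ∈ highCells K h lam)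
    (hkl : k < l) :
    max (t (k - 1)) (min (t l) v) - max (t (k - 1)) (min (t l) u) ≤
      (t l - t (k - 1)) * ∑ j ∈ (highCells K h lam).filter (fun j => k < j ∧ j ≤ l),
        (rise K h t lam j v - rise K h t lam j u) := by
  induction l using Nat.strong_induction_on with
  | _ l ih =>
    have hmem : l ∈ (highCells K h lam).filter (fun j => k < j ∧ j ≤ l) :=
      Finset.mem_filter.2 ⟨hl, hkl, le_rfl⟩
    have hk' := mem_highCells.1 hk
    have hl' := mem_highCells.1 hl
    have hΔ : ∀ j ∈ highCells K h lam, 0 ≤ rise K h t lam j v - rise K h t lam j u :=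
      fun j hj => sub_nonneg.2 (rise_mono ht hj huv)
    have hle := le_prevHigh hk hkl
    have hp0 : prevHigh K h lam l ≠ 0 := by omega
    have hps := prevHigh_spec hp0
    have hlen := prevHigh_lt ht hl hp0
    have hr : ∀ z, rise K h t lam l z * (t l - t (prevHigh K h lam l - 1))
        = max (t (prevHigh K h lam l - 1)) (min (t l) z) - t (prevHigh K h lam l - 1) := by
      intro z
      rw [rise, if_neg hp0, ramp_mul hlen]
    rw [← Finset.add_sum_erase _ _ hmem]
    have hrest : 0 ≤ ∑ j ∈ ((highCells K h lam).filter (fun j => k < j ∧ j ≤ l)).erase l,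
        (rise K h t lam j v - rise K h t lam j u) :=
      Finset.sum_nonneg fun j hj =>
        hΔ j (Finset.mem_filter.1 (Finset.mem_of_mem_erase hj)).1
    rcases hle.eq_or_lt with heq | hlt
    · have h1 := hr v
      have h2 := hr u
      rw [← heq] at h1 h2 hlen
      nlinarith
    · have hih := ih _ hps.2 hps.1 hlt
      set m := prevHigh K h lam l with hm
      have hsub : (highCells K h lam).filter (fun j => k < j ∧ j ≤ m) ⊆
          ((highCells K h lam).filter (fun j => k < j ∧ j ≤ l)).erase l := by
        intro j hj
        rw [Finset.mem_erase, Finset.mem_filter]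
        rw [Finset.mem_filter] at hj
        exact ⟨by omega, hj.1, hj.2.1, by omega⟩
      have hS := Finset.sum_le_sum_of_subset_of_nonneg hsub
        (f := fun j => rise K h t lam j v - rise K h t lam j u)
        fun j hj _ => hΔ j (Finset.mem_filter.1 (Finset.mem_of_mem_erase hj)).1
      have hm' := mem_highCells.1 hps.1
      have hS0 : 0 ≤ ∑ j ∈ (highCells K h lam).filter (fun j => k < j ∧ j ≤ m),
          (rise K h t lam j v - rise K h t lam j u) :=
        Finset.sum_nonneg fun j hj => hΔ j (Finset.mem_filter.1 hj).1
      have e1 : t (k - 1) ≤ t (m - 1) := le_of_strict ht (by omega) (by omega)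
      have e2 : t (m - 1) ≤ t m := le_of_strict ht (by omega) (by omega)
      have e3 : t m ≤ t l := le_of_strict ht (by omega) (by omega)
      have c1 := clip_add_clip (z := v) (e1.trans e2) e3
      have c2 := clip_add_clip (z := u) (e1.trans e2) e3
      have c3 := clip_sub_le (r := t l) e2 huv
      have r1 := hr v
      have r2 := hr u
      have hl0 := hΔ l hl
      set A := rise K h t lam l v - rise K h t lam l u with hA
      have r3 : A * (t l - t (m - 1)) ≤ A * (t l - t (k - 1)) :=
        mul_le_mul_of_nonneg_left (by linarith) hl0
      have r4 : (t m - t (k - 1)) * ∑ j ∈ (highCells K h lam).filter (fun j => k < j ∧ j ≤ m),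
          (rise K h t lam j v - rise K h t lam j u) ≤ (t l - t (k - 1)) *
          ∑ j ∈ ((highCells K h lam).filter (fun j => k < j ∧ j ≤ l)).erase l,
            (rise K h t lam j v - rise K h t lam j u) :=
        mul_le_mul (by linarith) hS hS0 (by linarith)
      have r5 : A * (t l - t (m - 1)) = max (t (m - 1)) (min (t l) v)
          - max (t (m - 1)) (min (t l) u) := by rw [hA]; linarith
      rw [mul_add]
      linarith

/-- At lower levels the upper potential grows at least as fast as a ramp of a higher level. -/
theorem upperPot_growth (ht : ∀ i j, i < j → j ≤ K → t i < t j) {lam' : ℝ} (hlam : lam' ≤ lam)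
    {l : ℕ} (hl : l ∈ highCells K h lam) (hp : prevHigh K h lam l ≠ 0) {u v : ℝ} (huv : u ≤ v)
    (hu : t (prevHigh K h lam l - 1) ≤ u) (hv : v ≤ t l) :
    2 * (v - u) ≤ (t l - t (prevHigh K h lam l - 1)) *
      (upperPot K h t lam' v - upperPot K h t lam' u) := by
  have hps := prevHigh_spec hp
  have h1 := clip_le_sum_rise ht (highCells_anti hlam hps.1) huv l (highCells_anti hlam hl) hps.2
  have hlen := prevHigh_lt ht hl hp
  rw [min_eq_right hv, min_eq_right (huv.trans hv), max_eq_right hu,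
    max_eq_right (hu.trans huv)] at h1
  have h2 := Finset.sum_le_sum_of_subset_of_nonneg (Finset.filter_subset
      (fun j => prevHigh K h lam l < j ∧ j ≤ l) (highCells K h lam'))
    (f := fun j => rise K h t lam' j v - rise K h t lam' j u)
    fun j hj _ => sub_nonneg.2 (rise_mono ht hj huv)
  have h3 : upperPot K h t lam' v - upperPot K h t lam' u
      = 2 * ∑ j ∈ highCells K h lam', (rise K h t lam' j v - rise K h t lam' j u) := by
    unfold upperPot
    rw [Finset.sum_sub_distrib, ← Finset.mul_sum, ← Finset.mul_sum]
    ring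
  rw [h3]
  have h4 := mul_le_mul_of_nonneg_left h2 (sub_pos.2 hlen).le
  linarith

end Combinatorics

noncomputable section

/-- The potential at level `lam` of a point `x` where the maximal function has the value `m`. -/
def levelPot (K : ℕ) (h t : ℕ → ℝ) (m x lam : ℝ) : ℝ :=
  if lam ≤ m then upperPot K h t lam x else lowerPot K h t lam x

end

/-! ### Growth of the potential over one rise and fall -/

section Steps

variable {K : ℕ} {h t : ℕ → ℝ}

/-- Passing a cell higher than both ends of a step. -/
theorem levelPot_step_of_cell (ht : ∀ i j, i < j → j ≤ K → t i < t j) {k : ℕ} (hk1 : 1 ≤ k)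
    (hkK : k ≤ K) {x x' m m' : ℝ} (hx : x ≤ t (k - 1)) (hx' : t k ≤ x') (hm : m < h k)
    (hm' : m' < h k)
    (hoff : ∀ j, 1 ≤ j → j ≤ K → m' < h j → x' ≤ t (j - 1) ∨ t j ≤ x') (lam : ℝ) :
    levelPot K h t m x lam + (2 * (if lam ≤ h k then 1 else 0) - (if lam ≤ m then 1 else 0)
      - (if lam ≤ m' then 1 else 0)) ≤ levelPot K h t m' x' lam := by
  have hkk : t (k - 1) < t k := ht _ _ (by omega) hkK
  have hxx : x ≤ x' := by linarith
  unfold levelPot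
  by_cases hp : lam ≤ h k
  · have hk : k ∈ highCells K h lam := mem_highCells.2 ⟨⟨hk1, hkK⟩, hp⟩
    rw [if_pos hp]
    -- The required gains in the four cases are 0, 1, 1 and 2.
    by_cases h1 : lam ≤ m <;> by_cases h2 : lam ≤ m'
    · simp only [h1, h2, if_true]
      linarith [upperPot_mono (h := h) (lam := lam) ht hxx]
    · simp only [h1, h2, if_true, if_false]
      have hoff' : ∀ j ∈ highCells K h lam, x' ≤ t (j - 1) ∨ t j ≤ x' := fun j hj => by
        have := mem_highCells.1 hj
        exact hoff j this.1.1 this.1.2 ((not_le.1 h2).trans_le this.2)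
      rcases upperPot_le_lowerPot ht hxx hoff' ⟨k, hk, hx'⟩ with h3 | ⟨l, hl, hp0, -, -, h4, h5⟩
      · linarith
      · have h6 := h4 k hk hx'
        have h7 := prevHigh_spec hp0
        have h8 := mem_highCells.1 h7.1
        rw [rise_eq_zero ht hl fun _ => hx.trans (le_of_strict ht (by omega) (by omega))] at h5
        linarith
    · simp only [h1, h2, if_true, if_false]
      rcases lowerPot_le_upperPot ht hxx ⟨k, hk, by linarith⟩ with h3 | ⟨l, hl, hp0, -, -, h4, h5⟩
      · linarith
      · have h6 := h4 k hk (by linarith)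
        rw [rise_eq_one ht hl hp0 ((le_of_strict ht h6 hkK).trans hx')] at h5
        linarith
    · simp only [h1, h2, if_false]
      have hsub : insert k ((highCells K h lam).filter fun l => t l ≤ x) ⊆
          (highCells K h lam).filter fun l => t l ≤ x' := by
        intro j hj
        rw [Finset.mem_filter]
        rcases Finset.mem_insert.1 hj with rfl | hj
        · exact ⟨hk, hx'⟩
        · exact ⟨(Finset.mem_filter.1 hj).1, (Finset.mem_filter.1 hj).2.trans hxx⟩
      have hnot : k ∉ (highCells K h lam).filter fun l => t l ≤ x := fun hmem => by
        linarith [(Finset.mem_filter.1 hmem).2]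
      have hcard := Finset.card_le_card hsub
      rw [Finset.card_insert_of_notMem hnot] at hcard
      have hcard' : (((highCells K h lam).filter fun l => t l ≤ x).card : ℝ) + 1 ≤
          ((highCells K h lam).filter fun l => t l ≤ x').card := by exact_mod_cast hcard
      unfold lowerPot
      linarith
  · have h1 : ¬ lam ≤ m := fun hh => hp (hh.trans hm.le)
    have h2 : ¬ lam ≤ m' := fun hh => hp (hh.trans hm'.le)
    simp only [hp, h1, h2, if_false]
    linarith [lowerPot_mono (K := K) (h := h) (t := t) (lam := lam) hxx]

/-- Losses at the levels between `m` and `p` are compensated by gains at the levels below `m`. -/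
theorem sum_levels_nonneg {S : Finset ℝ} {δ r e : ℝ → ℝ} (hδ : ∀ l ∈ S, 0 ≤ δ l) {m p : ℝ}
    (hm : 0 ≤ m) (hmp : m < p) (hsm : ∑ l ∈ S, (if l ≤ m then δ l else 0) = m)
    (hsp : ∑ l ∈ S, (if l ≤ p then δ l else 0) = p)
    (hpair : ∀ l' ∈ S, ∀ l ∈ S, l' ≤ m → m < l → l ≤ p → 0 ≤ e l * (p - m) + m * r l')
    (hzero : m = 0 → ∀ l ∈ S, m < l → l ≤ p → 0 ≤ e l) :
    0 ≤ ∑ l ∈ S, δ l * (if l ≤ m then r l else if l ≤ p then e l else 0) := by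
  rcases hm.eq_or_lt with h0 | h0
  · refine Finset.sum_nonneg fun l hl => ?_
    by_cases h1 : l ≤ m
    · have h2 : δ l = 0 := by
        have h3 := (Finset.sum_eq_zero_iff_of_nonneg (s := S)
          (f := fun l => if l ≤ m then δ l else 0) (fun l hl => by
            split_ifs
            · exact hδ l hl
            · exact le_rfl)).1 (by rw [hsm, ← h0]) l hl
        simpa [h1] using h3
      simp [h2]
    · by_cases h2 : l ≤ p
      · simp only [h1, h2, if_true, if_false]
        exact mul_nonneg (hδ l hl) (hzero h0.symm l hl (not_le.1 h1) h2)
      · simp [h1, h2]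
  · set A : ℝ → ℝ := fun l => if l ≤ m then δ l else 0 with hA
    set B : ℝ → ℝ := fun l => if l ≤ m then 0 else if l ≤ p then δ l else 0 with hB
    have hAB : ∀ l, A l + B l = if l ≤ p then δ l else 0 := by
      intro l
      simp only [hA, hB]
      by_cases h1 : l ≤ m
      · simp [h1, h1.trans hmp.le]
      · simp [h1]
    have hsB : ∑ l ∈ S, B l = p - m := by
      have : ∑ l ∈ S, (A l + B l) = p := by rw [← hsp]; exact Finset.sum_congr rfl fun l _ => hAB l
      rw [Finset.sum_add_distrib, hsm] at this
      linarith
    have hsplit : ∑ l ∈ S, δ l * (if l ≤ m then r l else if l ≤ p then e l else 0)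
        = ∑ l ∈ S, A l * r l + ∑ l ∈ S, B l * e l := by
      rw [← Finset.sum_add_distrib]
      refine Finset.sum_congr rfl fun l _ => ?_
      simp only [hA, hB]
      split_ifs <;> ring
    -- The levels up to m have total weight m and those in (m, p] have total weight p - m. Summing
    -- the pair inequality over both groups therefore gives m * (p - m) times the desired sum.
    have hdouble : 0 ≤ ∑ l' ∈ S, ∑ l ∈ S, A l' * B l * (e l * (p - m) + m * r l') := by
      refine Finset.sum_nonneg fun l' hl' => Finset.sum_nonneg fun l hl => ?_
      simp only [hA, hB]
      by_cases h1 : l' ≤ m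
      · by_cases h2 : l ≤ m
        · simp [h2]
        · by_cases h3 : l ≤ p
          · simp only [h1, h2, h3, if_true, if_false]
            exact mul_nonneg (mul_nonneg (hδ _ hl') (hδ _ hl))
              (hpair l' hl' l hl h1 (not_le.1 h2) h3)
          · simp [h2, h3]
      · simp [h1]
    have hfac : ∑ l' ∈ S, ∑ l ∈ S, A l' * B l * (e l * (p - m) + m * r l')
        = (m * (p - m)) * (∑ l ∈ S, A l * r l + ∑ l ∈ S, B l * e l) := by
      have e1 : ∀ l' ∈ S, ∑ l ∈ S, A l' * B l * (e l * (p - m) + m * r l')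
          = A l' * ((p - m) * ∑ l ∈ S, B l * e l) + (A l' * r l') * (m * (p - m)) := by
        intro l' _
        rw [← hsB, Finset.mul_sum, Finset.mul_sum, Finset.mul_sum, Finset.mul_sum,
          ← Finset.sum_add_distrib]
        exact Finset.sum_congr rfl fun l _ => by ring
      rw [Finset.sum_congr rfl e1, Finset.sum_add_distrib, ← Finset.sum_mul, ← Finset.sum_mul, hsm]
      ring
    rw [hfac] at hdouble
    rw [hsplit]
    exact nonneg_of_mul_nonneg_right hdouble (mul_pos h0 (sub_pos.2 hmp))

/-- An ascent from `x` to the centre `y` of an interval whose right end is that of a cell `j` at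
least as high as the average. -/
theorem ascent_nonneg (ht : ∀ i j, i < j → j ≤ K → t i < t j) {S : Finset ℝ} {δ : ℝ → ℝ}
    (hδ : ∀ l ∈ S, 0 ≤ δ l) {m p : ℝ} (hm : 0 ≤ m) (hmp : m < p)
    (hsm : ∑ l ∈ S, (if l ≤ m then δ l else 0) = m)
    (hsp : ∑ l ∈ S, (if l ≤ p then δ l else 0) = p) {j : ℕ} (hj1 : 1 ≤ j) (hjK : j ≤ K)
    (hpj : p ≤ h j) {x y : ℝ} (hxy : x ≤ y) (hyj : y < t j)
    (hrat : t 0 ≤ x → p * (t j - y) ≤ m * (t j - x)) :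
    0 ≤ ∑ l ∈ S, δ l * (if l ≤ m then upperPot K h t l y - upperPot K h t l x else
      if l ≤ p then upperPot K h t l y - lowerPot K h t l x - 1 else 0) := by
  have key : ∀ l ∈ S, m < l → l ≤ p → 0 ≤ upperPot K h t l y - lowerPot K h t l x - 1 ∨
      (0 < m ∧ ∀ l' ∈ S, l' ≤ m → 0 ≤ (upperPot K h t l y - lowerPot K h t l x - 1) * (p - m)
        + m * (upperPot K h t l' y - upperPot K h t l' x)) := by
    intro lam _ h1 h2
    have hj : j ∈ highCells K h lam := mem_highCells.2 ⟨⟨hj1, hjK⟩, h2.trans hpj⟩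
    rcases lowerPot_le_upperPot ht hxy ⟨j, hj, by linarith⟩ with h3 | ⟨l, hl, hp0, hpx, hxl, h4, h5⟩
    · left; linarith
    rcases le_or_gt (t l) y with hly | hly
    · left
      rw [rise_eq_one ht hl hp0 hly] at h5
      linarith
    right
    have hps := prevHigh_spec hp0
    have hpm := mem_highCells.1 hps.1
    have hlj : t l ≤ t j := le_of_strict ht (h4 j hj (by linarith)) hjK
    have hlen := prevHigh_lt ht hl hp0
    have hα : t (prevHigh K h lam l - 1) ≤ x :=
      (le_of_strict ht (by omega) (by omega)).trans hpx
    have hr := hrat ((le_of_strict ht (Nat.zero_le _) (by omega)).trans hpx)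
    have hrise : rise K h t lam l y * (t l - t (prevHigh K h lam l - 1))
        = y - t (prevHigh K h lam l - 1) := by
      rw [rise, if_neg hp0, ramp_mul hlen, min_eq_right hly.le, max_eq_right (hα.trans hxy)]
    -- The ratio hypothesis says (p - m) * (t j - y) ≤ m * (y - x). Since l is the first high cell
    -- ending beyond x, `t l ≤ t j`, and the left side only decreases.
    have hr' : (p - m) * (t l - y) ≤ m * (y - x) := by nlinarith
    have hm0 : 0 < m := by
      rcases hm.eq_or_lt with h0 | h0
      · rw [← h0] at hr'
        nlinarith
      · exact h0
    refine ⟨hm0, fun l' _ hl'm => ?_⟩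
    have hg := upperPot_growth ht (hl'm.trans h1.le) hl hp0 hxy hα hly.le
    set α := t (prevHigh K h lam l - 1)
    set E := upperPot K h t lam y - lowerPot K h t lam x - 1 with hE
    set R := upperPot K h t l' y - upperPot K h t l' x
    have hD : 0 < t l - α := sub_pos.2 hlen
    have e1 : -2 * (t l - y) ≤ E * (t l - α) := by
      have : -2 * (1 - rise K h t lam l y) ≤ E := by linarith
      nlinarith
    have e2 : 0 ≤ (E * (p - m) + m * R) * (t l - α) := by
      have e3 := mul_le_mul_of_nonneg_left e1 (sub_pos.2 hmp).le
      have e4 := mul_le_mul_of_nonneg_left hg hm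
      nlinarith
    exact nonneg_of_mul_nonneg_left e2 hD
  refine sum_levels_nonneg hδ hm hmp hsm hsp (fun l' hl' l hl h1 h2 h3 => ?_)
    fun h0 l hl h2 h3 => ?_
  · rcases key l hl h2 h3 with h4 | h4
    · exact add_nonneg (mul_nonneg h4 (sub_pos.2 hmp).le)
        (mul_nonneg hm (sub_nonneg.2 (upperPot_mono ht hxy)))
    · exact h4.2 l' hl' h1
  · rcases key l hl h2 h3 with h4 | h4
    · exact h4
    · exact absurd h0 h4.1.ne'

/-- A descent to `x` from the centre `y` of an interval whose left end is that of a cell `i` at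
least as high as the average. -/
theorem descent_nonneg (ht : ∀ i j, i < j → j ≤ K → t i < t j) {S : Finset ℝ} {δ : ℝ → ℝ}
    (hδ : ∀ l ∈ S, 0 ≤ δ l) {m p : ℝ} (hm : 0 ≤ m) (hmp : m < p)
    (hsm : ∑ l ∈ S, (if l ≤ m then δ l else 0) = m)
    (hsp : ∑ l ∈ S, (if l ≤ p then δ l else 0) = p) {i : ℕ} (hi1 : 1 ≤ i) (hiK : i ≤ K)
    (hpi : p ≤ h i) {x y : ℝ} (hyx : y ≤ x) (hiy : t i ≤ y)
    (hoff : ∀ j, 1 ≤ j → j ≤ K → m < h j → x ≤ t (j - 1) ∨ t j ≤ x)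
    (hrat : p * (y - t (i - 1)) ≤ m * (x - t (i - 1))) :
    0 ≤ ∑ l ∈ S, δ l * (if l ≤ m then upperPot K h t l x - upperPot K h t l y else
      if l ≤ p then lowerPot K h t l x - upperPot K h t l y - 1 else 0) := by
  have key : ∀ l ∈ S, m < l → l ≤ p → 0 ≤ lowerPot K h t l x - upperPot K h t l y - 1 ∨
      (0 < m ∧ ∀ l' ∈ S, l' ≤ m → 0 ≤ (lowerPot K h t l x - upperPot K h t l y - 1) * (p - m)
        + m * (upperPot K h t l' x - upperPot K h t l' y)) := by
    intro lam _ h1 h2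
    have hi : i ∈ highCells K h lam := mem_highCells.2 ⟨⟨hi1, hiK⟩, h2.trans hpi⟩
    have hoff' : ∀ j ∈ highCells K h lam, x ≤ t (j - 1) ∨ t j ≤ x := fun j hj => by
      have := mem_highCells.1 hj
      exact hoff j this.1.1 this.1.2 (h1.trans_le this.2)
    rcases upperPot_le_lowerPot ht hyx hoff' ⟨i, hi, hiy.trans hyx⟩ with
      h3 | ⟨l, hl, hp0, hpx, hxl, h4, h5⟩
    · left; linarith
    have hps := prevHigh_spec hp0
    have hpm := mem_highCells.1 hps.1
    have hlm := mem_highCells.1 hl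
    rcases le_or_gt y (t (prevHigh K h lam l - 1)) with hly | hly
    · left
      rw [rise_eq_zero ht hl fun _ => hly] at h5
      linarith
    right
    have hil : t (i - 1) ≤ t (prevHigh K h lam l - 1) :=
      le_of_strict ht (Nat.sub_le_sub_right (h4 i hi (hiy.trans hyx)) 1) (by omega)
    have hlen := prevHigh_lt ht hl hp0
    have hxl' : x ≤ t l := hxl.trans (le_of_strict ht (by omega) (by omega))
    have hrise : rise K h t lam l y * (t l - t (prevHigh K h lam l - 1))
        = y - t (prevHigh K h lam l - 1) := by
      rw [rise, if_neg hp0, ramp_mul hlen, min_eq_right (hyx.trans hxl'), max_eq_right hly.le]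
    have hr' : (p - m) * (y - t (prevHigh K h lam l - 1)) ≤ m * (x - y) := by nlinarith
    have hm0 : 0 < m := by
      rcases hm.eq_or_lt with h0 | h0
      · rw [← h0] at hr'
        nlinarith
      · exact h0
    refine ⟨hm0, fun l' _ hl'm => ?_⟩
    have hg := upperPot_growth ht (hl'm.trans h1.le) hl hp0 hyx hly.le hxl'
    set α := t (prevHigh K h lam l - 1)
    set E := lowerPot K h t lam x - upperPot K h t lam y - 1 with hE
    set R := upperPot K h t l' x - upperPot K h t l' y
    have hD : 0 < t l - α := sub_pos.2 hlen
    have e1 : -2 * (y - α) ≤ E * (t l - α) := by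
      have : -2 * rise K h t lam l y ≤ E := by linarith
      nlinarith
    have e2 : 0 ≤ (E * (p - m) + m * R) * (t l - α) := by
      have e3 := mul_le_mul_of_nonneg_left e1 (sub_pos.2 hmp).le
      have e4 := mul_le_mul_of_nonneg_left hg hm
      nlinarith
    exact nonneg_of_mul_nonneg_left e2 hD
  refine sum_levels_nonneg hδ hm hmp hsm hsp (fun l' hl' l hl h1 h2 h3 => ?_)
    fun h0 l hl h2 h3 => ?_
  · rcases key l hl h2 h3 with h4 | h4
    · exact add_nonneg (mul_nonneg h4 (sub_pos.2 hmp).le)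
        (mul_nonneg hm (sub_nonneg.2 (upperPot_mono ht hyx)))
    · exact h4.2 l' hl' h1
  · rcases key l hl h2 h3 with h4 | h4
    · exact h4
    · exact absurd h0 h4.1.ne'

theorem sum_levels_indicator {S : Finset ℝ} {δ : ℝ → ℝ} {p m m' : ℝ}
    (hsm : ∑ l ∈ S, (if l ≤ m then δ l else 0) = m)
    (hsm' : ∑ l ∈ S, (if l ≤ m' then δ l else 0) = m')
    (hsp : ∑ l ∈ S, (if l ≤ p then δ l else 0) = p) :
    ∑ l ∈ S, δ l * (2 * (if l ≤ p then 1 else 0) - (if l ≤ m then 1 else 0)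
      - (if l ≤ m' then 1 else 0)) = 2 * p - m - m' := by
  rw [← hsm, ← hsm', ← hsp, Finset.mul_sum, ← Finset.sum_sub_distrib, ← Finset.sum_sub_distrib,
    hsm, hsm', hsp]
  refine Finset.sum_congr rfl fun l _ => ?_
  split_ifs <;> ring

/-- Passing an interval from the left end of a cell `i` to the right end of a cell `j`, both at
least as high as its average `p`, and with centre between them. -/
theorem levelPot_step_of_interval (ht : ∀ i j, i < j → j ≤ K → t i < t j) {S : Finset ℝ}
    {δ : ℝ → ℝ} (hδ : ∀ l ∈ S, 0 ≤ δ l) {m m' p : ℝ} (hm : 0 ≤ m) (hmp : m < p) (hm' : 0 ≤ m')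
    (hmp' : m' < p) (hsm : ∑ l ∈ S, (if l ≤ m then δ l else 0) = m)
    (hsm' : ∑ l ∈ S, (if l ≤ m' then δ l else 0) = m')
    (hsp : ∑ l ∈ S, (if l ≤ p then δ l else 0) = p) {i j : ℕ} (hi1 : 1 ≤ i) (hiK : i ≤ K)
    (hj1 : 1 ≤ j) (hjK : j ≤ K) (hpi : p ≤ h i) (hpj : p ≤ h j) {x y x' : ℝ} (hxy : x ≤ y)
    (hyx : y ≤ x') (hiy : t i ≤ y) (hyj : y < t j)
    (hoff : ∀ j, 1 ≤ j → j ≤ K → m' < h j → x' ≤ t (j - 1) ∨ t j ≤ x')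
    (hrat : t 0 ≤ x → p * (t j - y) ≤ m * (t j - x))
    (hrat' : p * (y - t (i - 1)) ≤ m' * (x' - t (i - 1))) :
    ∑ l ∈ S, δ l * levelPot K h t m x l + (2 * p - m - m')
      ≤ ∑ l ∈ S, δ l * levelPot K h t m' x' l := by
  have h1 := ascent_nonneg ht hδ hm hmp hsm hsp hj1 hjK hpj hxy hyj hrat
  have h2 := descent_nonneg ht hδ hm' hmp' hsm' hsp hi1 hiK hpi hyx hiy hoff hrat'
  have h3 := sum_levels_indicator hsm hsm' hsp
  have h4 := add_nonneg h1 h2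
  rw [← Finset.sum_add_distrib] at h4
  have h5 : ∀ l ∈ S, δ l * levelPot K h t m x l + δ l * (2 * (if l ≤ p then 1 else 0)
      - (if l ≤ m then 1 else 0) - (if l ≤ m' then 1 else 0))
      + (δ l * (if l ≤ m then upperPot K h t l y - upperPot K h t l x else
          if l ≤ p then upperPot K h t l y - lowerPot K h t l x - 1 else 0)
        + δ l * (if l ≤ m' then upperPot K h t l x' - upperPot K h t l y else
          if l ≤ p then lowerPot K h t l x' - upperPot K h t l y - 1 else 0))
      ≤ δ l * levelPot K h t m' x' l := by
    intro l hl
    rw [← mul_add, ← mul_add, ← mul_add]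
    refine mul_le_mul_of_nonneg_left ?_ (hδ l hl)
    unfold levelPot
    by_cases hp : l ≤ p
    · by_cases c1 : l ≤ m <;> by_cases c2 : l ≤ m' <;>
        simp only [hp, c1, c2, if_true, if_false] <;> linarith
    · have c1 : ¬ l ≤ m := fun hh => hp (hh.trans hmp.le)
      have c2 : ¬ l ≤ m' := fun hh => hp (hh.trans hmp'.le)
      simp only [hp, c1, c2, if_false]
      linarith [lowerPot_mono (K := K) (h := h) (t := t) (lam := l) (hxy.trans hyx)]
  have h6 := Finset.sum_le_sum h5
  rw [Finset.sum_add_distrib, Finset.sum_add_distrib, h3] at h6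
  linarith

end Steps

/-- The relation between the heights `h` and break points `t` of a nonnegative step function, a
primitive `M` of it, and its centered maximal function `g`. The function has the value `h 0` to
the left of `t 0`, the value `h k` between `t (k - 1)` and `t k`, and the value `h (K + 1)` to the
right of `t K`. -/
structure IsStepMaximal (K : ℕ) (h t : ℕ → ℝ) (M g : ℝ → ℝ) : Prop where
  strict : ∀ i j, i < j → j ≤ K → t i < t j
  nonneg : ∀ k, 0 ≤ h k
  slope : ∀ k ≤ K + 1, ∀ u v, u ≤ v → (0 < k → t (k - 1) ≤ u) → (k ≤ K → v ≤ t k) →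
    M v - M u = h k * (v - u)
  mono : Monotone M
  le_of_heights : ∀ H, (∀ k ≤ K + 1, h k ≤ H) → ∀ x, g x ≤ H
  average_le : ∀ x r, 0 < r → M (x + r) - M (x - r) ≤ g x * (2 * r)
  exists_average : ∀ x q, q < g x → ∃ r, 0 < r ∧ q * (2 * r) < M (x + r) - M (x - r)

/-! ### Intervals of large average -/

namespace IsStepMaximal

variable {K : ℕ} {h t : ℕ → ℝ} {M g : ℝ → ℝ}

theorem interval_le (H : IsStepMaximal K h t M g) {x l R : ℝ} (hlR : l < R) (hx : l + R = 2 * x) :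
    M R - M l ≤ g x * (R - l) := by
  have := H.average_le x ((R - l) / 2) (by linarith)
  rw [show x + (R - l) / 2 = R by linarith, show x - (R - l) / 2 = l by linarith,
    show 2 * ((R - l) / 2) = R - l by ring] at this
  exact this

theorem nonneg_maximal (H : IsStepMaximal K h t M g) (x : ℝ) : 0 ≤ g x := by
  have h1 := H.average_le x 1 one_pos
  have h2 := H.mono (show x - 1 ≤ x + 1 by linarith)
  linarith

theorem height_le (H : IsStepMaximal K h t M g) {k : ℕ} (hk : k ≤ K + 1) {x : ℝ}
    (h1 : 0 < k → t (k - 1) < x) (h2 : k ≤ K → x < t k) : h k ≤ g x := by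
  obtain ⟨r, hr, hr1, hr2⟩ : ∃ r : ℝ, 0 < r ∧ (0 < k → t (k - 1) ≤ x - r) ∧
      (k ≤ K → x + r ≤ t k) := by
    by_cases c1 : 0 < k <;> by_cases c2 : k ≤ K
    · refine ⟨min (x - t (k - 1)) (t k - x), lt_min (by linarith [h1 c1]) (by linarith [h2 c2]),
        fun _ => ?_, fun _ => ?_⟩
      · linarith [min_le_left (x - t (k - 1)) (t k - x)]
      · linarith [min_le_right (x - t (k - 1)) (t k - x)]
    · exact ⟨x - t (k - 1), by linarith [h1 c1], fun _ => by linarith, fun c => absurd c c2⟩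
    · exact ⟨t k - x, by linarith [h2 c2], fun c => absurd c c1, fun _ => by linarith⟩
    · exact ⟨1, one_pos, fun c => absurd c c1, fun c => absurd c c2⟩
  have h3 := H.average_le x r hr
  rw [H.slope k hk _ _ (by linarith) hr1 hr2] at h3
  nlinarith

theorem off_cell (H : IsStepMaximal K h t M g) {k : ℕ} (hk : k ≤ K) {x : ℝ} (hx : g x < h k) :
    x ≤ t (k - 1) ∨ t k ≤ x := by
  by_contra! hcon
  exact absurd (H.height_le (hk.trans (Nat.le_succ K)) (fun _ => hcon.1) fun _ => hcon.2)
    (not_le.2 hx)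

/-- A break point is assigned to the cell on its left, as suits right ends of intervals;
`exists_cell_right` has the opposite convention for left ends. The index K + 1 stands for the
unbounded last cell. -/
theorem exists_cell_left (t : ℕ → ℝ) (K : ℕ) (R : ℝ) :
    ∃ k ≤ K + 1, (0 < k → t (k - 1) < R) ∧ (k ≤ K → R ≤ t k) := by
  classical
  have hex : ∃ k, K < k ∨ R ≤ t k := ⟨K + 1, Or.inl (Nat.lt_succ_self K)⟩
  refine ⟨Nat.find hex, Nat.find_min' hex (Or.inl (Nat.lt_succ_self K)), fun h0 => ?_, fun hK => ?_⟩
  · have := Nat.find_min hex (m := Nat.find hex - 1) (by omega)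
    push Not at this
    exact this.2
  · exact (Nat.find_spec hex).resolve_left (not_lt.2 hK)

theorem exists_cell_right {𝕂 : Type*} [LinearOrder 𝕂] (t : ℕ → 𝕂) (K : ℕ) (l : 𝕂) :
    ∃ k ≤ K + 1, (0 < k → t (k - 1) ≤ l) ∧ (k ≤ K → l < t k) := by
  classical
  have hex : ∃ k, K < k ∨ l < t k := ⟨K + 1, Or.inl (Nat.lt_succ_self K)⟩
  refine ⟨Nat.find hex, Nat.find_min' hex (Or.inl (Nat.lt_succ_self K)), fun h0 => ?_, fun hK => ?_⟩
  · have := Nat.find_min hex (m := Nat.find hex - 1) (by omega)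
    push Not at this
    exact this.2
  · exact (Nat.find_spec hex).resolve_left (not_lt.2 hK)

/-- The right end of an interval of large average can be moved to a break point. -/
theorem move_right_end (H : IsStepMaximal K h t M g) {x x' l R A : ℝ} (hlR : l < R)
    (hx : 2 * x < l + R) (hx' : l + R < 2 * x') (hgx : g x < A) (hgx' : g x' < A)
    (hA : A * (R - l) ≤ M R - M l) :
    ∃ j ≤ K, l < t j ∧ 2 * x < l + t j ∧ l + t j < 2 * x' ∧ A * (t j - l) ≤ M (t j) - M l := by
  obtain ⟨k, hk, h1, h2⟩ := exists_cell_left t K R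
  rcases le_or_gt A (h k) with hAk | hAk
  · have hno : ∀ R', R ≤ R' → (k ≤ K → R' ≤ t k) → R' = 2 * x' - l → False := by
      intro R' hR' hk' he
      have s1 := H.slope k hk R R' hR' (fun c => (h1 c).le) hk'
      have s2 := H.interval_le (x := x') (show l < R' by linarith) (by linarith)
      nlinarith
    have hkK : k ≤ K := by
      by_contra hcon
      exact hno (2 * x' - l) (by linarith) (fun c => absurd c hcon) rfl
    have hRk := h2 hkK
    have s1 := H.slope k hk R (t k) hRk (fun c => (h1 c).le) fun _ => le_rfl
    refine ⟨k, hkK, by linarith, by linarith, ?_, by nlinarith⟩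
    by_contra hcon
    exact hno (2 * x' - l) (by linarith) (fun _ => by linarith) rfl
  · have hcell : ¬ (0 < k → t (k - 1) ≤ l) := by
      intro hl
      have s1 := H.slope k hk l R hlR.le hl h2
      nlinarith
    push Not at hcell
    obtain ⟨hk0, hl⟩ := hcell
    have hR := h1 hk0
    have s1 := H.slope k hk _ R hR.le (fun _ => le_rfl) h2
    refine ⟨k - 1, by omega, hl, ?_, by linarith, by nlinarith⟩
    by_contra hcon
    have s2 := H.slope k hk (2 * x - l) R (by linarith) (fun _ => by linarith) h2
    have s3 := H.interval_le (x := x) (show l < 2 * x - l by linarith) (by linarith)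
    nlinarith

/-- The left end of an interval of large average can be moved to a break point. -/
theorem move_left_end (H : IsStepMaximal K h t M g) {x x' l R A : ℝ} (hlR : l < R)
    (hx : 2 * x < l + R) (hx' : l + R < 2 * x') (hgx : g x < A) (hgx' : g x' < A)
    (hA : A * (R - l) ≤ M R - M l) :
    ∃ i ≤ K, t i < R ∧ 2 * x < t i + R ∧ t i + R < 2 * x' ∧ A * (R - t i) ≤ M R - M (t i) := by
  obtain ⟨k, hk, h1, h2⟩ := exists_cell_right t K l
  rcases le_or_gt A (h k) with hAk | hAk
  · have hno : ∀ l', l' ≤ l → (0 < k → t (k - 1) ≤ l') → l' = 2 * x - R → False := by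
      intro l' hl' hk' he
      have s1 := H.slope k hk l' l hl' hk' (fun c => (h2 c).le)
      have s2 := H.interval_le (x := x) (show l' < R by linarith) (by linarith)
      nlinarith
    have hk0 : 0 < k := by
      by_contra hcon
      exact hno (2 * x - R) (by linarith) (fun c => absurd c hcon) rfl
    have hlk := h1 hk0
    have s1 := H.slope k hk _ l hlk (fun _ => le_rfl) fun c => (h2 c).le
    refine ⟨k - 1, by omega, by linarith, ?_, by linarith, by nlinarith⟩
    by_contra hcon
    exact hno (2 * x - R) (by linarith) (fun _ => by linarith) rfl
  · have hcell : ¬ (k ≤ K → R ≤ t k) := by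
      intro hl
      have s1 := H.slope k hk l R hlR.le h1 hl
      nlinarith
    push Not at hcell
    obtain ⟨hkK, hR⟩ := hcell
    have hl := h2 hkK
    have s1 := H.slope k hk l _ hl.le h1 (fun _ => le_rfl)
    refine ⟨k, hkK, hR, by linarith, ?_, by nlinarith⟩
    by_contra hcon
    have s2 := H.slope k hk l (2 * x' - R) (by linarith) h1 (fun _ => by linarith)
    have s3 := H.interval_le (x := x') (show 2 * x' - R < R by linarith) (by linarith)
    nlinarith

/-- The average of the step function over the interval from `t i` to `t j`. -/
noncomputable def breakAverage (t : ℕ → ℝ) (M : ℝ → ℝ) (i j : ℕ) : ℝ :=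
  (M (t j) - M (t i)) / (t j - t i)

/-- No interval attaining `g y` is needed: for A just below `g y`, an interval of average above A
can be moved to break points, and the finitely many candidates have a best one. If one of its end
cells were lower than the best average, cutting that cell off would raise the average. Should the
cut push the centre out of (x, x'), cutting only until the centre reaches x or x' contradicts the
smaller value of g there. -/
theorem exists_best_interval (H : IsStepMaximal K h t M g) {x y x' : ℝ} (hxy : x < y)
    (hyx : y < x') (hgx : g x < g y) (hgx' : g x' < g y) :
    ∃ i j, i < j ∧ j ≤ K ∧ 2 * x < t i + t j ∧ t i + t j < 2 * x' ∧
      g y ≤ breakAverage t M i j ∧ breakAverage t M i j ≤ h (i + 1) ∧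
      breakAverage t M i j ≤ h j := by
  classical
  set C : Finset (ℕ × ℕ) := (Finset.range (K + 1) ×ˢ Finset.range (K + 1)).filter
    fun q => q.1 < q.2 ∧ 2 * x < t q.1 + t q.2 ∧ t q.1 + t q.2 < 2 * x' with hC
  have memC : ∀ i j, (i, j) ∈ C ↔ i < j ∧ j ≤ K ∧ 2 * x < t i + t j ∧ t i + t j < 2 * x' := by
    intro i j
    simp only [hC, Finset.mem_filter, Finset.mem_product, Finset.mem_range]
    constructor
    · rintro ⟨⟨-, h1⟩, h2, h3⟩; exact ⟨h2, by omega, h3⟩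
    · rintro ⟨h1, h2, h3⟩; exact ⟨⟨by omega, by omega⟩, h1, h3⟩
  have havg : ∀ i j, i < j → j ≤ K →
      breakAverage t M i j * (t j - t i) = M (t j) - M (t i) := fun i j hij hj =>
    div_mul_cancel₀ _ (sub_pos.2 (H.strict i j hij hj)).ne'
  have hcand : ∀ A, g x < A → g x' < A → A < g y → ∃ q ∈ C, A ≤ breakAverage t M q.1 q.2 := by
    intro A h1 h2 h3
    obtain ⟨r, hr, hr'⟩ := H.exists_average y A h3
    obtain ⟨j, hj, j1, j2, j3, j4⟩ := H.move_right_end (l := y - r) (R := y + r) (by linarith)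
      (by linarith) (by linarith) h1 h2 (by linarith)
    obtain ⟨i, hi, i1, i2, i3, i4⟩ := H.move_left_end j1 j2 j3 h1 h2 j4
    have hij : i < j := by
      by_contra hcon
      exact absurd i1 (not_lt.2 (le_of_strict H.strict (not_lt.1 hcon) hi))
    refine ⟨(i, j), (memC i j).2 ⟨hij, hj, i2, i3⟩, ?_⟩
    rw [breakAverage, le_div_iff₀ (by linarith)]
    exact i4
  have hμ : max (g x) (g x') < g y := max_lt hgx hgx'
  obtain ⟨A₀, hA₀, hA₀'⟩ := exists_between hμ
  have hCne : C.Nonempty := by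
    obtain ⟨q, hq, -⟩ := hcand A₀ ((le_max_left _ _).trans_lt hA₀)
      ((le_max_right _ _).trans_lt hA₀) hA₀'
    exact ⟨q, hq⟩
  obtain ⟨⟨i, j⟩, hij, hmax⟩ := Finset.exists_max_image C (fun q => breakAverage t M q.1 q.2) hCne
  obtain ⟨h1, h2, h3, h4⟩ := (memC i j).1 hij
  have hp : g y ≤ breakAverage t M i j := by
    refine le_of_forall_lt_imp_le_of_dense fun A hA => ?_
    rcases lt_or_ge A A₀ with hlt | hge
    · obtain ⟨q, hq, hq'⟩ := hcand A₀ ((le_max_left _ _).trans_lt hA₀)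
        ((le_max_right _ _).trans_lt hA₀) hA₀'
      exact hlt.le.trans (hq'.trans (hmax q hq))
    · obtain ⟨q, hq, hq'⟩ := hcand A ((le_max_left _ _).trans_lt (hA₀.trans_le hge))
        ((le_max_right _ _).trans_lt (hA₀.trans_le hge)) hA
      exact hq'.trans (hmax q hq)
  set p := breakAverage t M i j with hpdef
  have hpa := havg i j h1 h2
  rw [← hpdef] at hpa
  refine ⟨i, j, h1, h2, h3, h4, hp, ?_, ?_⟩
  · by_contra hcon
    push Not at hcon
    have hti := H.strict i (i + 1) (Nat.lt_succ_self i) (by omega)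
    have s1 := H.slope (i + 1) (by omega) (t i) (t (i + 1)) hti.le (fun _ => le_rfl) fun _ => le_rfl
    rcases (Nat.succ_le_of_lt h1).eq_or_lt with he | hlt
    · have he' : j = i + 1 := he.symm
      rw [he'] at hpa
      nlinarith
    · have htj := H.strict (i + 1) j hlt h2
      have hc : t (i + 1) + t j < 2 * x' := by
        by_contra hc
        have s2 := H.slope (i + 1) (by omega) (t i) (2 * x' - t j) (by linarith)
          (fun _ => le_rfl) fun _ => by push Not at hc; simpa using (by linarith)
        have s3 := H.interval_le (x := x') (show 2 * x' - t j < t j by linarith) (by linarith)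
        nlinarith
      have hm := hmax (i + 1, j) ((memC _ _).2 ⟨hlt, h2, by linarith, hc⟩)
      have ha := havg (i + 1) j hlt h2
      dsimp only at hm
      nlinarith
  · by_contra hcon
    push Not at hcon
    have htj := H.strict (j - 1) j (by omega) h2
    have s1 := H.slope j (by omega) (t (j - 1)) (t j) htj.le (fun _ => le_rfl) fun _ => le_rfl
    rcases (Nat.le_sub_one_of_lt h1).eq_or_lt with he | hlt
    · rw [he] at hpa
      nlinarith
    · have hti := H.strict i (j - 1) hlt (by omega)
      have hc : 2 * x < t i + t (j - 1) := by
        by_contra hc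
        have s2 := H.slope j (by omega) (2 * x - t i) (t j) (by linarith)
          (fun _ => by linarith) fun _ => le_rfl
        have s3 := H.interval_le (x := x) (show t i < 2 * x - t i by linarith) (by linarith)
        nlinarith
      have hm := hmax (i, j - 1) ((memC _ _).2 ⟨hlt, by omega, hc, by linarith⟩)
      have ha := havg i (j - 1) hlt (by omega)
      dsimp only at hm
      nlinarith

/-- Along a rise to `g y` and a fall from it the total potential grows by the variation. -/
theorem potential_step (H : IsStepMaximal K h t M g) {S : Finset ℝ} {δ : ℝ → ℝ}
    (hδ : ∀ l ∈ S, 0 ≤ δ l)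
    (hSh : ∀ k ≤ K + 1, ∑ l ∈ S, (if l ≤ h k then δ l else 0) = h k)
    (hSa : ∀ i j, i < j → j ≤ K → ∑ l ∈ S, (if l ≤ breakAverage t M i j then δ l else 0)
      = breakAverage t M i j) {x y x' m : ℝ} (hxy : x < y) (hyx : y < x') (hgx : g x < g y)
    (hgx' : g x' < g y) (hm : 0 ≤ m) (hmx : m ≤ g x) (hmv : t 0 ≤ x → m = g x)
    (hsm : ∑ l ∈ S, (if l ≤ m then δ l else 0) = m)
    (hsm' : ∑ l ∈ S, (if l ≤ g x' then δ l else 0) = g x') :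
    ∑ l ∈ S, δ l * levelPot K h t m x l + (2 * g y - m - g x')
      ≤ ∑ l ∈ S, δ l * levelPot K h t (g x') x' l := by
  obtain ⟨i, j, hij, hj, hc, hc', hp, hpi, hpj⟩ := H.exists_best_interval hxy hyx hgx hgx'
  have hoff : ∀ k, 1 ≤ k → k ≤ K → g x' < h k → x' ≤ t (k - 1) ∨ t k ≤ x' :=
    fun k _ hk hh => H.off_cell hk hh
  have hcell : ∀ k, 1 ≤ k → k ≤ K → breakAverage t M i j ≤ h k → x < t k → t (k - 1) < x' →
      ∑ l ∈ S, δ l * levelPot K h t m x l + (2 * g y - m - g x')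
        ≤ ∑ l ∈ S, δ l * levelPot K h t (g x') x' l := by
    intro k hk1 hkK hpk hxk hkx
    have hgk := hp.trans hpk
    have hx1 : x ≤ t (k - 1) := (H.off_cell hkK (hgx.trans_le hgk)).resolve_right (not_le.2 hxk)
    have hx2 : t k ≤ x' := (H.off_cell hkK (hgx'.trans_le hgk)).resolve_left (not_le.2 hkx)
    have h1 := fun l => levelPot_step_of_cell H.strict hk1 hkK hx1 hx2
      ((hmx.trans_lt hgx).trans_le hgk) (hgx'.trans_le hgk) hoff l
    have h2 := Finset.sum_le_sum fun l hl => mul_le_mul_of_nonneg_left (h1 l) (hδ l hl)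
    simp only [mul_add] at h2
    rw [Finset.sum_add_distrib, sum_levels_indicator hsm hsm' (hSh k (by omega))] at h2
    linarith
  -- If the centre lies in an end cell, that whole cell lies between x and x', since g exceeds both
  -- `g x` and `g x'` in its interior.
  rcases lt_or_ge (t (j - 1)) ((t i + t j) / 2) with hyj | hyj
  · exact hcell j (by omega) hj hpj (by linarith [H.strict i j hij hj]) (by linarith)
  rcases lt_or_ge ((t i + t j) / 2) (t (i + 1)) with hyi | hyi
  · exact hcell (i + 1) (by omega) (by omega) hpi (by linarith)
      (by simpa using (by linarith [H.strict i j hij hj] : t i < x'))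
  have htij := H.strict i j hij hj
  have hpa : breakAverage t M i j * (t j - t i) = M (t j) - M (t i) :=
    div_mul_cancel₀ _ (sub_pos.2 htij).ne'
  have h1 := levelPot_step_of_interval (x := x) (x' := x') (y := (t i + t j) / 2) (i := i + 1)
    (j := j) (m := m) (m' := g x') (p := breakAverage t M i j) H.strict hδ hm
    ((hmx.trans_lt hgx).trans_le hp) (H.nonneg_maximal x') (hgx'.trans_le hp) hsm hsm'
    (hSa i j hij hj) (by omega) (by omega) (by omega) hj hpi hpj (by linarith) (by linarith) hyi
    (by linarith) hoff ?_ ?_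
  · linarith
  · intro hx0
    rw [hmv hx0]
    -- The interval about x with right end `t j` contains [t i, t j], and its average is at most `g
    -- x`.
    have h2 := H.interval_le (x := x) (show 2 * x - t j < t j by linarith) (by linarith)
    have h3 := H.mono (show 2 * x - t j ≤ t i by linarith)
    linarith
  · have h2 := H.interval_le (x := x') (show t i < 2 * x' - t i by linarith) (by linarith)
    have h3 := H.mono (show t j ≤ 2 * x' - t i by linarith)
    simp only [Nat.add_sub_cancel]
    linarith

end IsStepMaximal

/-! ### The potential is bounded by the jumps -/

/-- The number of changes of a `0`-`1` sequence without adjacent ones among its inner terms. -/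
theorem sum_abs_sub_zero_one {K : ℕ} (hK : 1 ≤ K) {e : ℕ → ℝ} (he : ∀ k, e k = 0 ∨ e k = 1)
    (hsep : ∀ k, 1 ≤ k → k < K → e k = 0 ∨ e (k + 1) = 0) :
    ∑ k ∈ Finset.range (K + 1), |e k - e (k + 1)| = e 0 - 2 * e 0 * e 1
      + 2 * ∑ k ∈ Finset.Icc 1 K, e k + e (K + 1) - 2 * e K * e (K + 1) := by
  have hpart : ∀ n, 1 ≤ n → n ≤ K → ∑ k ∈ Finset.range n, |e k - e (k + 1)|
      = e 0 - 2 * e 0 * e 1 + 2 * ∑ k ∈ Finset.Icc 1 n, e k - e n := by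
    intro n hn
    induction n, hn using Nat.le_induction with
    | base =>
      intro _
      simp only [Finset.range_one, Finset.sum_singleton, Finset.Icc_self, zero_add]
      rcases he 0 with h0 | h0 <;> rcases he 1 with h1 | h1 <;> rw [h0, h1] <;> norm_num
    | succ n hn ih =>
      intro hnK
      rw [Finset.sum_range_succ, ih (by omega), Finset.sum_Icc_succ_top (by omega)]
      rcases hsep n hn (by omega) with h0 | h0
      · rcases he (n + 1) with h1 | h1 <;> (rw [h0, h1]; norm_num; try ring)
      · rcases he n with h1 | h1 <;> rw [h0, h1] <;> norm_num
  rw [Finset.sum_range_succ, hpart K hK le_rfl]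
  rcases he K with h0 | h0 <;> rcases he (K + 1) with h1 | h1 <;> rw [h0, h1] <;> norm_num <;> ring

namespace IsStepMaximal

variable {K : ℕ} {h t : ℕ → ℝ} {M g : ℝ → ℝ}

/-- At each level, the potential is bounded by the number of times the step function crosses
that level. -/
theorem levelPot_le (H : IsStepMaximal K h t M g) (hK : 1 ≤ K)
    (hsep : ∀ k, 1 ≤ k → k < K → h k = 0 ∨ h (k + 1) = 0) (hab : h 0 ≤ h (K + 1)) {x m : ℝ}
    (hmx : m ≤ g x) (hmv : t 0 ≤ x → m = g x) (hma : h 0 ≤ m) {lam : ℝ} (hlam : 0 < lam) :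
    levelPot K h t m x lam + (if lam ≤ m then 0 else if lam ≤ h (K + 1) then 1 else 0) ≤
      (if lam ≤ h 0 then 1 else 0) + ∑ k ∈ Finset.range (K + 1),
        |(if lam ≤ h k then (1 : ℝ) else 0) - (if lam ≤ h (k + 1) then 1 else 0)| := by
  set e : ℕ → ℝ := fun k => if lam ≤ h k then 1 else 0 with he
  have he01 : ∀ k, e k = 0 ∨ e k = 1 := fun k => by
    simp only [he]; split_ifs <;> simp
  have hnot : ∀ k, h k = 0 → e k = 0 := fun k hk => by
    simp only [he, hk]; rw [if_neg (not_le.2 hlam)]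
  have hform := sum_abs_sub_zero_one hK he01
    fun k h1 h2 => (hsep k h1 h2).imp (hnot k) (hnot (k + 1))
  have hN : ∑ k ∈ Finset.Icc 1 K, e k = ((highCells K h lam).card : ℝ) := by
    simp only [he, highCells, Finset.sum_boole]
  change levelPot K h t m x lam + _ ≤ e 0 + ∑ k ∈ Finset.range (K + 1), |e k - e (k + 1)|
  rw [hform, hN]
  have hmem : ∀ k, 1 ≤ k → k ≤ K → e k = 1 → (highCells K h lam).Nonempty := by
    intro k h1 h2 h3
    refine ⟨k, mem_highCells.2 ⟨⟨h1, h2⟩, ?_⟩⟩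
    by_contra hcon
    simp only [he, if_neg hcon] at h3
    norm_num at h3
  have hle1 : ∀ k, e k ≤ 1 := fun k => by rcases he01 k with h1 | h1 <;> rw [h1] <;> norm_num
  have hU : upperPot K h t lam x ≤ 2 * ((highCells K h lam).card : ℝ) - 1 ∨
      ((highCells K h lam).card = 0 ∧ upperPot K h t lam x = 1 ∧ e 1 = 0 ∧ e K = 0) := by
    rcases (highCells K h lam).eq_empty_or_nonempty with hemp | hne
    · right
      refine ⟨by simp [hemp], by simp [upperPot, hemp], ?_, ?_⟩
      · exact (he01 1).resolve_right fun h1 => by simpa [hemp] using hmem 1 le_rfl hK h1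
      · exact (he01 K).resolve_right fun h1 => by simpa [hemp] using hmem K hK le_rfl h1
    · exact Or.inl (upperPot_le hne x)
  have hV : lowerPot K h t lam x ≤ 2 * ((highCells K h lam).card : ℝ) := by
    unfold lowerPot
    have : (((highCells K h lam).filter fun l => t l ≤ x).card : ℝ) ≤ (highCells K h lam).card := by
      exact_mod_cast Finset.card_filter_le _ _
    linarith
  by_cases ha : lam ≤ h 0
  · have h0 : e 0 = 1 := by simp [he, ha]
    have h1 : e (K + 1) = 1 := by simp [he, ha.trans hab]
    have hm : lam ≤ m := ha.trans hma
    simp only [levelPot, if_pos hm, h0, h1]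
    rcases hU with hU | ⟨hc, hU, h2, h3⟩
    · linarith [hle1 1, hle1 K]
    · rw [hc, hU, h2, h3]; norm_num
  have h0 : e 0 = 0 := by simp [he, ha]
  by_cases hb : lam ≤ h (K + 1)
  · have h1 : e (K + 1) = 1 := by simp [he, hb]
    by_cases hm : lam ≤ m
    · simp only [levelPot, if_pos hm, h0, h1]
      rcases hU with hU | ⟨hc, hU, h2, h3⟩
      · linarith [hle1 K]
      · rw [hc, hU, h2, h3]; norm_num
    · simp only [levelPot, if_neg hm, if_pos hb, h0, h1]
      rcases he01 K with hK0 | hK1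
      · rw [hK0]; linarith
      · have hlK : lam ≤ h K := by
          by_contra hcon
          simp only [he, if_neg hcon] at hK1
          norm_num at hK1
        have htK : t (K - 1) < t K := H.strict _ _ (by omega) le_rfl
        -- The last two cells both reach the level, so from `t K` on g is at least lam. At `t K`
        -- itself this holds because both neighbours are high.
        have hxK : x < t K := by
          by_contra hcon
          push Not at hcon
          have hmg := hmv ((le_of_strict H.strict (Nat.zero_le K) le_rfl).trans hcon)
          rcases hcon.eq_or_lt with heq | hlt
          · have s1 := H.interval_le (x := x) (l := t (K - 1)) (R := 2 * x - t (K - 1))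
              (by linarith) (by ring)
            have s2 := H.slope K (by omega) (t (K - 1)) (t K) htK.le (fun _ => le_rfl)
              fun _ => le_rfl
            have s3 := H.slope (K + 1) le_rfl (t K) (2 * x - t (K - 1)) (by linarith)
              (fun _ => le_rfl) fun hh => by omega
            rw [← heq] at s1 s3
            rw [hmg, ← heq] at hm
            push Not at hm
            nlinarith
          · have := H.height_le (k := K + 1) le_rfl (fun _ => hlt) fun hh => by omega
            exact hm (hb.trans (this.trans hmg.ge))
        have hcard : ((highCells K h lam).filter fun l => t l ≤ x).card + 1
            ≤ (highCells K h lam).card := by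
          refine Finset.card_lt_card (Finset.filter_ssubset.2 ⟨K, ?_, not_le.2 hxK⟩)
          exact mem_highCells.2 ⟨⟨hK, le_rfl⟩, hlK⟩
        have hcard' : (((highCells K h lam).filter fun l => t l ≤ x).card : ℝ) + 1
            ≤ (highCells K h lam).card := by exact_mod_cast hcard
        rw [hK1]
        unfold lowerPot
        linarith
  · have h1 : e (K + 1) = 0 := by simp [he, hb]
    by_cases hm : lam ≤ m
    · simp only [levelPot, if_pos hm, h0, h1]
      rcases hU with hU | ⟨hc, -, -, -⟩
      · linarith
      · exfalso
        have hlt : ∀ k ≤ K + 1, h k < lam := by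
          intro k hk
          by_contra hcon
          push Not at hcon
          rcases Nat.eq_zero_or_pos k with rfl | hk0
          · exact ha hcon
          rcases hk.eq_or_lt with rfl | hk1
          · exact hb hcon
          have : k ∈ highCells K h lam := mem_highCells.2 ⟨⟨hk0, by omega⟩, hcon⟩
          rw [Finset.card_eq_zero.1 hc] at this
          simp at this
        have hne : (Finset.range (K + 2)).Nonempty := ⟨0, by simp⟩
        obtain ⟨k, hk, hmax⟩ := Finset.exists_max_image (Finset.range (K + 2)) h hne
        have s1 := H.le_of_heights (h k) (fun j hj => hmax j (by simp; omega)) x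
        have s2 := hlt k (by simp at hk; omega)
        linarith
    · simp only [levelPot, if_neg hm, if_neg hb, h0, h1]
      linarith

/-- Weighting the levels turns crossing counts into jumps of the heights. The extra maximum on the
left is a reserve that pays for a sequence ending in an ascent to at most `h (K + 1)`. -/
theorem potential_le (H : IsStepMaximal K h t M g) (hK : 1 ≤ K)
    (hsep : ∀ k, 1 ≤ k → k < K → h k = 0 ∨ h (k + 1) = 0) (hab : h 0 ≤ h (K + 1))
    {S : Finset ℝ} {δ : ℝ → ℝ} (hS : ∀ l ∈ S, 0 < l) (hδ : ∀ l ∈ S, 0 ≤ δ l)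
    (hSh : ∀ k ≤ K + 1, ∑ l ∈ S, (if l ≤ h k then δ l else 0) = h k) {x m : ℝ}
    (hmx : m ≤ g x) (hmv : t 0 ≤ x → m = g x) (hma : h 0 ≤ m)
    (hsm : ∑ l ∈ S, (if l ≤ m then δ l else 0) = m) :
    ∑ l ∈ S, δ l * levelPot K h t m x l + max (h (K + 1) - m) 0 ≤
      h 0 + ∑ k ∈ Finset.range (K + 1), |h k - h (k + 1)| := by
  have h1 := Finset.sum_le_sum fun l hl => mul_le_mul_of_nonneg_left
    (H.levelPot_le hK hsep hab hmx hmv hma (hS l hl)) (hδ l hl)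
  simp only [mul_add] at h1
  rw [Finset.sum_add_distrib, Finset.sum_add_distrib] at h1
  have h2 : ∑ l ∈ S, δ l * (if l ≤ h 0 then 1 else 0) = h 0 := by
    rw [← hSh 0 (Nat.zero_le _)]
    exact Finset.sum_congr rfl fun l _ => by rw [hSh 0 (Nat.zero_le _)]; split_ifs <;> ring
  have h3 : max (h (K + 1) - m) 0 ≤
      ∑ l ∈ S, δ l * (if l ≤ m then 0 else if l ≤ h (K + 1) then 1 else 0) := by
    refine max_le ?_ (Finset.sum_nonneg fun l hl => mul_nonneg (hδ l hl) ?_)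
    · calc h (K + 1) - m = ∑ l ∈ S, ((if l ≤ h (K + 1) then δ l else 0)
            - (if l ≤ m then δ l else 0)) := by
            rw [Finset.sum_sub_distrib, hSh (K + 1) le_rfl, hsm]
        _ ≤ _ := Finset.sum_le_sum fun l hl => by
            have := hδ l hl
            split_ifs <;> linarith
    · split_ifs <;> norm_num
  have h4 : ∑ l ∈ S, δ l * ∑ k ∈ Finset.range (K + 1),
      |(if l ≤ h k then (1 : ℝ) else 0) - (if l ≤ h (k + 1) then 1 else 0)|
      = ∑ k ∈ Finset.range (K + 1), |h k - h (k + 1)| := by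
    simp only [Finset.mul_sum]
    rw [Finset.sum_comm]
    refine Finset.sum_congr rfl fun k hk => ?_
    have hk' : k ≤ K := by simpa [Nat.lt_succ_iff] using hk
    have e1 := hSh k (by omega)
    have e2 := hSh (k + 1) (by omega)
    rcases le_total (h k) (h (k + 1)) with hle | hle
    · rw [abs_of_nonpos (sub_nonpos.2 hle)]
      calc _ = ∑ l ∈ S, ((if l ≤ h (k + 1) then δ l else 0) - (if l ≤ h k then δ l else 0)) := by
            refine Finset.sum_congr rfl fun l _ => ?_
            by_cases c1 : l ≤ h k
            · simp [c1, c1.trans hle]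
            · by_cases c2 : l ≤ h (k + 1) <;> simp [c1, c2]
        _ = _ := by rw [Finset.sum_sub_distrib, e1, e2]; ring
    · rw [abs_of_nonneg (sub_nonneg.2 hle)]
      calc _ = ∑ l ∈ S, ((if l ≤ h k then δ l else 0) - (if l ≤ h (k + 1) then δ l else 0)) := by
            refine Finset.sum_congr rfl fun l _ => ?_
            by_cases c1 : l ≤ h (k + 1)
            · simp [c1, c1.trans hle]
            · by_cases c2 : l ≤ h k <;> simp [c1, c2]
        _ = _ := by rw [Finset.sum_sub_distrib, e1, e2]
  rw [h2, h4] at h1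
  linarith

/-! ### Behaviour near infinity -/

theorem sub_le_right (H : IsStepMaximal K h t M g) {z : ℝ} (hz : t 0 ≤ z) :
    M z - M (t 0) ≤ M (t K) - M (t 0) + h (K + 1) * (z - t 0) := by
  have h0K := le_of_strict H.strict (Nat.zero_le K) le_rfl
  have hb := H.nonneg (K + 1)
  rcases le_total z (t K) with hzK | hzK
  · have := H.mono hzK
    nlinarith
  · have := H.slope (K + 1) le_rfl (t K) z hzK (fun _ => le_rfl) fun hh => by omega
    nlinarith

theorem sub_le_left (H : IsStepMaximal K h t M g) {z : ℝ} (hz : z ≤ t K) :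
    M (t K) - M z ≤ M (t K) - M (t 0) + h 0 * (t K - z) := by
  have h0K := le_of_strict H.strict (Nat.zero_le K) le_rfl
  have ha := H.nonneg 0
  rcases le_total (t 0) z with hzK | hzK
  · have := H.mono hzK
    nlinarith
  · have := H.slope 0 (Nat.zero_le _) z (t 0) hzK (fun hh => absurd hh (lt_irrefl 0)) fun _ => le_rfl
    nlinarith

theorem mean_le (H : IsStepMaximal K h t M g) (x : ℝ) : (h 0 + h (K + 1)) / 2 ≤ g x := by
  by_contra! hcon
  have h0K := le_of_strict H.strict (Nat.zero_le K) le_rfl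
  have ha := H.nonneg 0
  have hb := H.nonneg (K + 1)
  set D := h 0 * |t 0 - x| + h (K + 1) * |t K - x| with hD
  have hD0 : 0 ≤ D := by positivity
  set ε := (h 0 + h (K + 1)) / 2 - g x with hε
  have hε0 : 0 < ε := by linarith
  -- The radius is large enough to reach both unbounded cells and to make the end correction D
  -- smaller than r * ε.
  set r := |t 0 - x| + |t K - x| + 1 + D / ε with hr
  have hDε : 0 ≤ D / ε := div_nonneg hD0 hε0.le
  have a1 := abs_nonneg (t 0 - x)
  have a2 := abs_nonneg (t K - x)
  have hrD : D < r * ε := by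
    have : D = D / ε * ε := (div_mul_cancel₀ _ hε0.ne').symm
    nlinarith
  have b1 := neg_abs_le (t 0 - x)
  have b2 := le_abs_self (t K - x)
  have b3 := neg_abs_le (t K - x)
  have s1 := H.average_le x r (by linarith)
  have s2 := H.slope 0 (Nat.zero_le _) (x - r) (t 0) (by linarith)
    (fun hh => absurd hh (lt_irrefl 0)) fun _ => le_rfl
  have s3 := H.slope (K + 1) le_rfl (t K) (x + r) (by linarith) (fun _ => le_rfl)
    fun hh => by omega
  have s4 := H.mono h0K
  have c1 : h 0 * (r - |t 0 - x|) ≤ h 0 * (t 0 - (x - r)) :=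
    mul_le_mul_of_nonneg_left (by linarith) ha
  have c2 : h (K + 1) * (r - |t K - x|) ≤ h (K + 1) * (x + r - t K) :=
    mul_le_mul_of_nonneg_left (by linarith) hb
  have c3 : g x = (h 0 + h (K + 1)) / 2 - ε := by rw [hε]; ring
  rw [c3] at s1
  nlinarith

/-- An interval centred far to the left either stays in the first cell, or has radius above C / (q -
c). In the second case at most half of it lies beyond `t 0`, so its mass is at most 2cr + C. -/
theorem exists_far_left (H : IsStepMaximal K h t M g) (hab : h 0 ≤ h (K + 1)) {q : ℝ}
    (hq : (h 0 + h (K + 1)) / 2 < q) : ∃ X, ∀ x ≤ X, g x < q := by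
  set c := (h 0 + h (K + 1)) / 2 with hc
  set C := M (t K) - M (t 0) with hC
  have hC0 : 0 ≤ C := sub_nonneg.2 (H.mono (le_of_strict H.strict (Nat.zero_le K) le_rfl))
  refine ⟨t 0 - C / (q - c) - 1, fun x hx => ?_⟩
  by_contra! hcon
  obtain ⟨r, hr, hr'⟩ := H.exists_average x ((c + q) / 2) (by linarith)
  have hdiv : 0 ≤ C / (q - c) := div_nonneg hC0 (by linarith)
  have hd : C < (t 0 - x) * (q - c) := by
    have : C = C / (q - c) * (q - c) := (div_mul_cancel₀ _ (by linarith)).symm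
    nlinarith
  rcases le_or_gt (x + r) (t 0) with h1 | h1
  · rw [H.slope 0 (Nat.zero_le _) (x - r) (x + r) (by linarith)
      (fun hh => absurd hh (lt_irrefl 0)) fun _ => h1] at hr'
    nlinarith
  · have s1 := H.slope 0 (Nat.zero_le _) (x - r) (t 0) (by linarith)
      (fun hh => absurd hh (lt_irrefl 0)) fun _ => le_rfl
    have s2 := H.sub_le_right h1.le
    have s3 : (h (K + 1) - h 0) * (x - t 0) ≤ 0 :=
      mul_nonpos_of_nonneg_of_nonpos (by linarith) (by linarith)
    have s4 : (c + q) / 2 * (2 * r) < 2 * c * r + C := by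
      rw [show 2 * c = h 0 + h (K + 1) by rw [hc]; ring]
      nlinarith
    nlinarith

theorem exists_far_right (H : IsStepMaximal K h t M g) (hab : h 0 ≤ h (K + 1)) {q : ℝ}
    (hq : h (K + 1) < q) : ∃ X, ∀ x, X ≤ x → g x < q := by
  set c := h (K + 1) with hc
  set C := M (t K) - M (t 0) with hC
  have hC0 : 0 ≤ C := sub_nonneg.2 (H.mono (le_of_strict H.strict (Nat.zero_le K) le_rfl))
  refine ⟨t K + C / (q - c) + 1, fun x hx => ?_⟩
  by_contra! hcon
  obtain ⟨r, hr, hr'⟩ := H.exists_average x ((c + q) / 2) (by linarith)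
  have hdiv : 0 ≤ C / (q - c) := div_nonneg hC0 (by linarith)
  have hd : C < (x - t K) * (q - c) := by
    have : C = C / (q - c) * (q - c) := (div_mul_cancel₀ _ (by linarith)).symm
    nlinarith
  rcases le_or_gt (t K) (x - r) with h1 | h1
  · rw [H.slope (K + 1) le_rfl (x - r) (x + r) (by linarith) (fun _ => h1)
      fun hh => by omega] at hr'
    nlinarith
  · have s1 := H.slope (K + 1) le_rfl (t K) (x + r) (by linarith) (fun _ => le_rfl)
      fun hh => by omega
    have s2 := H.sub_le_left h1.le
    have s3 : h 0 * (t K - (x - r)) ≤ c * (t K - (x - r)) :=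
      mul_le_mul_of_nonneg_right hab (by linarith)
    nlinarith

end IsStepMaximal

/-! ### Summation along a monotone sequence -/

namespace IsStepMaximal

variable {K : ℕ} {h t : ℕ → ℝ} {M g : ℝ → ℝ}

theorem exists_common_weights (F : Finset ℝ) :
    ∃ (S : Finset ℝ) (δ : ℝ → ℝ), (∀ l ∈ S, 0 < l) ∧ (∀ l ∈ S, 0 ≤ δ l) ∧
      ∀ q ∈ F, 0 ≤ q → ∑ l ∈ S, (if l ≤ q then δ l else 0) = q := by
  have hpos : ∀ q ∈ F.filter (0 < ·), 0 < q := fun q hq => (Finset.mem_filter.1 hq).2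
  obtain ⟨δ, h0, h1⟩ := exists_level_weights (F.filter (0 < ·)) hpos
  refine ⟨_, δ, hpos, h0, fun q hq hq0 => h1 q ?_⟩
  rcases hq0.eq_or_lt with h2 | h2
  · exact Or.inr h2.symm
  · exact Or.inl (Finset.mem_filter.2 ⟨hq, h2⟩)

/-- The variation of the maximal function along a finite sequence, when the step function is not
larger at the left end than at the right end. -/
theorem sum_variation_le (H : IsStepMaximal K h t M g) (hK : 1 ≤ K)
    (hsep : ∀ k, 1 ≤ k → k < K → h k = 0 ∨ h (k + 1) = 0) (hab : h 0 ≤ h (K + 1))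
    {u : ℕ → ℝ} (hu : Monotone u) (N : ℕ) :
    ∑ i ∈ Finset.range N, |g (u (i + 1)) - g (u i)| ≤
      ∑ k ∈ Finset.range (K + 1), |h k - h (k + 1)| - (h (K + 1) - h 0) / 2 := by
  classical
  set c := (h 0 + h (K + 1)) / 2 with hc
  have hc0 : 0 ≤ c := by have := H.nonneg 0; have := H.nonneg (K + 1); positivity
  have hcg : ∀ x, c ≤ g x := H.mean_le
  -- a point far to the left
  obtain ⟨x₀, hx₀t, hx₀u, hx₀⟩ : ∃ x₀, x₀ < t 0 ∧ x₀ < u 0 ∧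
      ∀ i ≤ N, c < g (u i) → g x₀ < g (u i) := by
    have hev : ∀ i ∈ Finset.range (N + 1), ∀ᶠ x in Filter.atBot, c < g (u i) → g x < g (u i) := by
      intro i _
      by_cases hi : c < g (u i)
      · obtain ⟨X, hX⟩ := H.exists_far_left hab hi
        exact (Filter.eventually_le_atBot X).mono fun x hx _ => hX x hx
      · exact Filter.Eventually.of_forall fun x hh => absurd hh hi
    have hall := (Filter.eventually_all_finset (Finset.range (N + 1))).2 hev
    obtain ⟨x, h1, h2, h3⟩ := (hall.and
      ((Filter.eventually_lt_atBot (t 0)).and (Filter.eventually_lt_atBot (u 0)))).exists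
    exact ⟨x, h2, h3, fun i hi => h1 i (by simp; omega)⟩
  -- a point far to the right
  obtain ⟨x₁, hx₁u, hx₁⟩ : ∃ x₁, u N < x₁ ∧ (h (K + 1) < g (u N) → g x₁ < g (u N)) := by
    by_cases hq : h (K + 1) < g (u N)
    · obtain ⟨X, hX⟩ := H.exists_far_right hab hq
      exact ⟨max X (u N + 1), by linarith [le_max_right X (u N + 1)],
        fun _ => hX _ (le_max_left _ _)⟩
    · exact ⟨u N + 1, by linarith, fun hh => absurd hh hq⟩
  obtain ⟨S, δ, hS, hδ, hF⟩ := exists_common_weights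
    ((Finset.range (K + 2)).image h ∪
      (Finset.range (K + 1) ×ˢ Finset.range (K + 1)).image (fun q => breakAverage t M q.1 q.2) ∪
      (Finset.range (N + 1)).image (fun i => g (u i)) ∪ {c, g x₁})
  have hSh : ∀ k ≤ K + 1, ∑ l ∈ S, (if l ≤ h k then δ l else 0) = h k := fun k hk => by
    refine hF _ ?_ (H.nonneg k)
    simp only [Finset.mem_union, Finset.mem_image]
    exact Or.inl (Or.inl (Or.inl ⟨k, by simp; omega, rfl⟩))
  have hSa : ∀ i j, i < j → j ≤ K → ∑ l ∈ S, (if l ≤ breakAverage t M i j then δ l else 0)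
      = breakAverage t M i j := fun i j hij hj => by
    have htij := H.strict i j hij hj
    refine hF _ ?_ (div_nonneg (sub_nonneg.2 (H.mono htij.le)) (by linarith))
    simp only [Finset.mem_union, Finset.mem_image]
    exact Or.inl (Or.inl (Or.inr ⟨(i, j), by simp; omega, rfl⟩))
  have hSu : ∀ i ≤ N, ∑ l ∈ S, (if l ≤ g (u i) then δ l else 0) = g (u i) := fun i hi => by
    refine hF _ ?_ (H.nonneg_maximal _)
    simp only [Finset.mem_union, Finset.mem_image]
    exact Or.inl (Or.inr ⟨i, by simp; omega, rfl⟩)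
  have hSc : ∑ l ∈ S, (if l ≤ c then δ l else 0) = c := hF _ (by simp) hc0
  have hS1 : ∑ l ∈ S, (if l ≤ g x₁ then δ l else 0) = g x₁ := hF _ (by simp) (H.nonneg_maximal _)
  set Φ : ℝ → ℝ → ℝ := fun m x => ∑ l ∈ S, δ l * levelPot K h t m x l with hΦ
  -- Left of `t 0` no cell is passed and no ramp has begun, so levels up to c contribute 1 and all
  -- others 0.
  have hΦ₀ : Φ c x₀ = c := by
    rw [← hSc, hSc]
    conv_rhs => rw [← hSc]
    refine Finset.sum_congr rfl fun l _ => ?_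
    unfold levelPot
    split_ifs with hl
    · rw [upperPot_eq_one H.strict hx₀t.le, mul_one]
    · have : ((highCells K h l).filter fun k => t k ≤ x₀) = ∅ :=
        Finset.filter_eq_empty_iff.2 fun k hk => not_le.2
          (hx₀t.trans_le (le_of_strict H.strict (Nat.zero_le k) (mem_highCells.1 hk).1.2))
      simp [lowerPot, this]
  -- the admissible starting points of an ascent
  set Low : ℝ → ℝ → ℝ → Prop := fun x m q =>
    (x = x₀ ∧ m = c) ∨ (m = g x ∧ m < q ∧ ∑ l ∈ S, (if l ≤ m then δ l else 0) = m) with hLow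
  -- The value c assigned to x₀ in place of `g x₀` is harmless: m = `g x` is required only from `t
  -- 0` on.
  have low_facts : ∀ {x m q}, Low x m q → m ≤ g x ∧ (t 0 ≤ x → m = g x) ∧ c ≤ m ∧
      ∑ l ∈ S, (if l ≤ m then δ l else 0) = m := by
    rintro x m q (⟨rfl, rfl⟩ | ⟨rfl, -, h2⟩)
    · exact ⟨hcg _, fun hh => absurd hh (not_le.2 hx₀t), le_rfl, hSc⟩
    · exact ⟨le_rfl, fun _ => rfl, hcg _, h2⟩
  have low_lt : ∀ {x m i}, i ≤ N → Low x m (g (u i)) → c < g (u i) → g x < g (u i) := by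
    rintro x m i hi (⟨rfl, rfl⟩ | ⟨rfl, h2, -⟩) hq
    · exact hx₀ i hi hq
    · exact h2
  have step : ∀ {x m y x' q}, Low x m q → x < y → y < x' → g x < g y → g x' < g y →
      ∑ l ∈ S, (if l ≤ g x' then δ l else 0) = g x' →
      Φ m x + (2 * g y - m - g x') ≤ Φ (g x') x' := by
    intro x m y x' q hl hxy hyx h1 h2 h3
    obtain ⟨f1, f2, f3, f4⟩ := low_facts hl
    exact H.potential_step hδ hSh hSa hxy hyx h1 h2 (hc0.trans f3) f1 f2 f4 h3
  have budget : ∀ {x m}, m ≤ g x → (t 0 ≤ x → m = g x) → c ≤ m →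
      ∑ l ∈ S, (if l ≤ m then δ l else 0) = m → Φ m x + max (h (K + 1) - m) 0 - c ≤
        ∑ k ∈ Finset.range (K + 1), |h k - h (k + 1)| - (h (K + 1) - h 0) / 2 := by
    intro x m f1 f2 f3 f4
    have := H.potential_le hK hsep hab hS hδ hSh f1 f2 (by linarith) f4
    linarith
  -- The induction keeps one of two states: rising from the last low point x, or falling from a peak
  -- y after x. A turn upwards completes a rise and fall, whose variation is absorbed by the
  -- potential.
  have main : ∀ n ≤ N,
      (∃ x m, Low x m (g (u n)) ∧ x < u n ∧
        ∑ i ∈ Finset.range n, |g (u (i + 1)) - g (u i)| ≤ Φ m x - c + (g (u n) - m)) ∨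
      (∃ x m y q, Low x m q ∧ x < y ∧ y < u n ∧ g x < g y ∧ g (u n) < g y ∧
        ∑ i ∈ Finset.range n, |g (u (i + 1)) - g (u i)| ≤
          Φ m x - c + (2 * g y - m - g (u n))) := by
    intro n
    induction n with
    | zero =>
      intro _
      refine Or.inl ⟨x₀, c, Or.inl ⟨rfl, rfl⟩, hx₀u, ?_⟩
      rw [hΦ₀, Finset.range_zero, Finset.sum_empty]
      linarith [hcg (u 0)]
    | succ n ih =>
      intro hn
      have hle : u n ≤ u (n + 1) := hu (Nat.le_succ n)
      rw [Finset.sum_range_succ]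
      rcases ih (by omega) with ⟨x, m, hl, hx, hs⟩ | ⟨x, m, y, q, hl, hxy, hyu, h1, h2, hs⟩
      · rcases le_or_gt (g (u n)) (g (u (n + 1))) with hg | hg
        · refine Or.inl ⟨x, m, hl.imp_right fun hh => ⟨hh.1, hh.2.1.trans_le hg, hh.2.2⟩,
            hx.trans_le hle, ?_⟩
          rw [abs_of_nonneg (sub_nonneg.2 hg)]
          linarith
        · have hlt : u n < u (n + 1) := lt_of_le_of_ne hle fun hh => by
            rw [hh] at hg; exact lt_irrefl _ hg
          refine Or.inr ⟨x, m, u n, _, hl, hx, hlt,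
            low_lt (by omega) hl ((hcg _).trans_lt hg), hg, ?_⟩
          rw [abs_of_neg (sub_neg.2 hg)]
          linarith
      · rcases le_or_gt (g (u (n + 1))) (g (u n)) with hg | hg
        · refine Or.inr ⟨x, m, y, q, hl, hxy, hyu.trans_le hle, h1, hg.trans_lt h2, ?_⟩
          rw [abs_of_nonpos (sub_nonpos.2 hg)]
          linarith
        · have hlt : u n < u (n + 1) := lt_of_le_of_ne hle fun hh => by
            rw [hh] at hg; exact lt_irrefl _ hg
          have hst := step hl hxy hyu h1 h2 (hSu n (by omega))
          refine Or.inl ⟨u n, g (u n), Or.inr ⟨rfl, hg, hSu n (by omega)⟩, hlt, ?_⟩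
          rw [abs_of_pos (sub_pos.2 hg)]
          linarith
  rcases main N le_rfl with ⟨x, m, hl, hx, hs⟩ | ⟨x, m, y, q, hl, hxy, hyu, h1, h2, hs⟩
  · obtain ⟨f1, f2, f3, f4⟩ := low_facts hl
    -- A final ascent to at most `h (K + 1)` is paid by the reserve in the budget. A higher one is
    -- completed by a descent to the far point x₁.
    rcases le_or_gt (g (u N)) (h (K + 1)) with hg | hg
    · have hb := budget f1 f2 f3 f4
      linarith [le_max_left (h (K + 1) - m) 0]
    · have hst := step hl hx hx₁u (low_lt le_rfl hl (by linarith)) (hx₁ hg) hS1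
      have hb := budget (x := x₁) le_rfl (fun _ => rfl) (hcg _) hS1
      linarith [le_max_right (h (K + 1) - g x₁) 0, hx₁ hg]
  · have hst := step hl hxy hyu h1 h2 (hSu N le_rfl)
    have hb := budget (x := u N) le_rfl (fun _ => rfl) (hcg _) (hSu N le_rfl)
    linarith [le_max_right (h (K + 1) - g (u N)) 0]

end IsStepMaximal

/-! ### Reflection and the variation bound -/

open MeasureTheory

namespace IsStepMaximal

variable {K : ℕ} {h t : ℕ → ℝ} {M g : ℝ → ℝ}

/-- The structure uses a primitive and never the values at break points, so reversing the half-open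
cells does no harm. This reduces the variation bound to `h 0 ≤ h (K + 1)`. -/
theorem reflect (H : IsStepMaximal K h t M g) :
    IsStepMaximal K (fun k => h (K + 1 - k)) (fun k => - t (K - k)) (fun z => - M (-z))
      (fun x => g (-x)) where
  strict i j hij hj := neg_lt_neg (H.strict _ _ (by omega) (by omega))
  nonneg k := H.nonneg _
  slope k hk u v huv h1 h2 := by
    have := H.slope (K + 1 - k) (by omega) (-v) (-u) (neg_le_neg huv)
      (fun h0 => by
        have := h2 (by omega)
        rw [show K + 1 - k - 1 = K - k by omega]
        linarith)
      (fun h0 => by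
        have := h1 (by omega)
        rw [show K + 1 - k = K - (k - 1) by omega]
        linarith)
    linarith
  mono u v huv := neg_le_neg (H.mono (neg_le_neg huv))
  le_of_heights B hB x := H.le_of_heights B (fun k hk => by
    have := hB (K + 1 - k) (by omega)
    rwa [show K + 1 - (K + 1 - k) = k by omega] at this) _
  average_le x r hr := by
    have := H.average_le (-x) r hr
    rw [show -(x + r) = -x - r by ring, show -(x - r) = -x + r by ring]
    linarith
  exists_average x q hq := by
    obtain ⟨r, hr, hr'⟩ := H.exists_average (-x) q hq
    refine ⟨r, hr, ?_⟩
    rw [show -(x + r) = -x - r by ring, show -(x - r) = -x + r by ring]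
    linarith

theorem eVariationOn_le (H : IsStepMaximal K h t M g) (hK : 1 ≤ K)
    (hsep : ∀ k, 1 ≤ k → k < K → h k = 0 ∨ h (k + 1) = 0) :
    eVariationOn g Set.univ ≤ ENNReal.ofReal
      (∑ k ∈ Finset.range (K + 1), |h k - h (k + 1)| - 1 / 2 * |h 0 - h (K + 1)|) := by
  have key : ∀ {h t : ℕ → ℝ} {M g : ℝ → ℝ}, IsStepMaximal K h t M g →
      (∀ k, 1 ≤ k → k < K → h k = 0 ∨ h (k + 1) = 0) → h 0 ≤ h (K + 1) →
      eVariationOn g Set.univ ≤ ENNReal.ofReal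
        (∑ k ∈ Finset.range (K + 1), |h k - h (k + 1)| - 1 / 2 * |h 0 - h (K + 1)|) := by
    intro h t M g H hsep hab
    unfold eVariationOn
    refine iSup_le ?_
    rintro ⟨n, u, hu, -⟩
    dsimp only
    simp only [edist_dist, Real.dist_eq]
    rw [← ENNReal.ofReal_sum_of_nonneg fun i _ => abs_nonneg _]
    refine ENNReal.ofReal_le_ofReal ((H.sum_variation_le hK hsep hab hu n).trans (le_of_eq ?_))
    rw [abs_of_nonpos (sub_nonpos.2 hab)]
    ring
  rcases le_total (h 0) (h (K + 1)) with hab | hab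
  · exact key H hsep hab
  · have h1 := key H.reflect (fun k hk1 hkK => by
      have := hsep (K - k) (by omega) (by omega)
      rw [show K - k + 1 = K + 1 - k by omega] at this
      rw [show K + 1 - (k + 1) = K - k by omega]
      exact this.symm) (by simpa using hab)
    have h2 := eVariationOn.comp_le_of_antitoneOn (fun x => g (-x)) (s := Set.univ)
      (t := Set.univ) (fun x : ℝ => -x) (fun x _ y _ hxy => neg_le_neg hxy) (Set.mapsTo_univ _ _)
    have h3 : (fun x => g (-x)) ∘ (fun x : ℝ => -x) = g := by funext x; simp
    rw [h3] at h2
    refine (h2.trans h1).trans (ENNReal.ofReal_le_ofReal (le_of_eq ?_))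
    rw [← Finset.sum_range_reflect]
    congr 1
    · refine Finset.sum_congr rfl fun k hk => ?_
      have hk' : k < K + 1 := Finset.mem_range.1 hk
      rw [abs_sub_comm]
      congr 3 <;> omega
    · simp [abs_sub_comm]

end IsStepMaximal

/-! ### Averages and the continuous maximal function -/

section Maximal

variable {f : ℝ → ℂ} {C : ℝ}

theorem setAverage_le (hf : ∀ a b, IntervalIntegrable (fun y => ‖f y‖) volume a b)
    (hC : ∀ y, ‖f y‖ ≤ C) (x : ℝ) {r : ℝ} (hr : 0 < r) :
    (1 / (2 * r)) * ∫ y in (x - r)..(x + r), ‖f y‖ ≤ C := by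
  have h1 : ∫ y in (x - r)..(x + r), ‖f y‖ ≤ ∫ _y in (x - r)..(x + r), C :=
    intervalIntegral.integral_mono (by linarith) (hf _ _) intervalIntegrable_const hC
  rw [intervalIntegral.integral_const, smul_eq_mul] at h1
  rw [one_div, inv_mul_le_iff₀ (by positivity)]
  linarith

theorem bddAbove_averages (hf : ∀ a b, IntervalIntegrable (fun y => ‖f y‖) volume a b)
    (hC : ∀ y, ‖f y‖ ≤ C) (x : ℝ) :
    BddAbove (Set.range fun r : Set.Ioi (0 : ℝ) =>
      (1 / (2 * (r : ℝ))) * ∫ y in (x - (r : ℝ))..(x + (r : ℝ)), ‖f y‖) := by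
  refine ⟨C, ?_⟩
  rintro _ ⟨r, rfl⟩
  exact setAverage_le hf hC x r.2

theorem integral_le_centeredMaximal
    (hf : ∀ a b, IntervalIntegrable (fun y => ‖f y‖) volume a b) (hC : ∀ y, ‖f y‖ ≤ C) (x : ℝ)
    {r : ℝ} (hr : 0 < r) :
    ∫ y in (x - r)..(x + r), ‖f y‖ ≤ centeredMaximal f x * (2 * r) := by
  have h1 := le_ciSup (bddAbove_averages hf hC x) ⟨r, hr⟩
  dsimp only at h1
  rw [one_div, inv_mul_le_iff₀ (by positivity)] at h1
  rw [mul_comm]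
  exact h1

theorem centeredMaximal_le_iff (hf : ∀ a b, IntervalIntegrable (fun y => ‖f y‖) volume a b)
    (hC : ∀ y, ‖f y‖ ≤ C) {x q : ℝ} :
    centeredMaximal f x ≤ q ↔ ∀ r, 0 < r → ∫ y in (x - r)..(x + r), ‖f y‖ ≤ q * (2 * r) := by
  constructor
  · intro h r hr
    exact (integral_le_centeredMaximal hf hC x hr).trans
      (mul_le_mul_of_nonneg_right h (by positivity))
  · intro h
    have : Nonempty (Set.Ioi (0 : ℝ)) := ⟨⟨1, Set.mem_Ioi.2 one_pos⟩⟩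
    refine ciSup_le fun r => ?_
    have hr : (0 : ℝ) < r := r.2
    rw [one_div, inv_mul_le_iff₀ (by positivity), mul_comm]
    exact h r hr

end Maximal

/-! ### Step functions over a linear order, for both ℝ and ℤ -/

section StepFunction

variable {𝕂 : Type*} [LinearOrder 𝕂] {K : ℕ}

/-- The values of a step function, cell by cell. -/
def cellValue (a b : ℂ) (α : Fin K → ℂ) (n : ℕ) : ℂ :=
  if n = 0 then a else if hn : n - 1 < K then α ⟨n - 1, hn⟩ else b

/-- The break points, indexed by the natural numbers. -/
def breakPoint {𝕂 : Type*} {K : ℕ} (t : Fin (K + 1) → 𝕂) (n : ℕ) : 𝕂 := t ⟨min n K, by omega⟩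

theorem breakPoint_val {𝕂 : Type*} {K : ℕ} (t : Fin (K + 1) → 𝕂) (k : Fin (K + 1)) : breakPoint t k = t k := by
  unfold breakPoint
  congr 1
  ext
  simp; omega

theorem breakPoint_lt {t : Fin (K + 1) → 𝕂} (ht : StrictMono t) {i j : ℕ} (hij : i < j)
    (hj : j ≤ K) : breakPoint t i < breakPoint t j := by
  apply ht
  rw [Fin.lt_def]
  simp; omega

theorem stepFunction_eq (a b : ℂ) (α : Fin K → ℂ) {t : Fin (K + 1) → 𝕂} (ht : StrictMono t)
    {n : ℕ} (hn : n ≤ K + 1) {x : 𝕂} (h1 : 0 < n → breakPoint t (n - 1) ≤ x)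
    (h2 : n ≤ K → x < breakPoint t n) : stepFunction a b α t x = cellValue a b α n := by
  have hlow : ∀ k : Fin (K + 1), (k : ℕ) < n → t k ≤ x := by
    intro k hk
    refine le_trans ?_ (h1 (by omega))
    rw [← breakPoint_val t k]
    rcases (show (k : ℕ) ≤ n - 1 by omega).eq_or_lt with he | hlt
    · rw [he]
    · exact (breakPoint_lt ht hlt (by omega)).le
  have hhigh : ∀ k : Fin (K + 1), n ≤ (k : ℕ) → x < t k := by
    intro k hk
    refine (h2 (by omega)).trans_le ?_
    rw [← breakPoint_val t k]
    rcases hk.eq_or_lt with he | hlt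
    · rw [he]
    · exact (breakPoint_lt ht hlt (by omega)).le
  have e0 : (Set.Iio (t 0)).indicator (fun _ => a) x = if n = 0 then a else 0 := by
    by_cases hn0 : n = 0
    · rw [if_pos hn0, Set.indicator_of_mem]
      exact hhigh 0 (by simp [hn0])
    · rw [if_neg hn0, Set.indicator_of_notMem]
      exact not_lt.2 (hlow 0 (by simp; omega))
  have e1 : (Set.Ici (t (Fin.last K))).indicator (fun _ => b) x = if n = K + 1 then b else 0 := by
    by_cases hn0 : n = K + 1
    · rw [if_pos hn0, Set.indicator_of_mem]
      exact hlow (Fin.last K) (by simp [hn0])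
    · rw [if_neg hn0, Set.indicator_of_notMem]
      exact not_le.2 (hhigh (Fin.last K) (by simp; omega))
  have e2 : ∀ k : Fin K, (Set.Ico (t k.castSucc) (t k.succ)).indicator (fun _ => α k) x
      = if n = (k : ℕ) + 1 then α k else 0 := by
    intro k
    by_cases hn0 : n = (k : ℕ) + 1
    · rw [if_pos hn0, Set.indicator_of_mem]
      exact ⟨hlow _ (by simp [hn0]), hhigh _ (by simp [hn0])⟩
    · rw [if_neg hn0, Set.indicator_of_notMem]
      rintro ⟨h3, h4⟩
      rcases Nat.lt_or_ge (k : ℕ) n with hlt | hge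
      · exact absurd h4 (not_lt.2 (hlow k.succ (by simp; omega)))
      · exact absurd h3 (not_le.2 (hhigh k.castSucc (by simpa using hge)))
  unfold stepFunction cellValue
  rw [e0, e1, Finset.sum_congr rfl fun k _ => e2 k]
  by_cases hn0 : n = 0
  · simp [hn0]
  rcases hn.eq_or_lt with he | hlt
  · rw [Finset.sum_eq_zero fun k _ => if_neg (by have := k.2; omega)]
    simp [he]
  · rw [if_neg hn0, if_neg hn0, if_neg hlt.ne, dif_pos (show n - 1 < K by omega),
      Finset.sum_eq_single (⟨n - 1, by omega⟩ : Fin K)]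
    · rw [if_pos (by simp; omega)]; ring
    · intro k _ hk
      rw [if_neg]
      intro he
      apply hk
      ext
      simp; omega
    · simp

/-- Monotone factorization through finitely many cell indices yields both bounded variation and
boundedness. -/
theorem exists_cellIndex (a b : ℂ) (α : Fin K → ℂ) {t : Fin (K + 1) → 𝕂} (ht : StrictMono t) :
    ∃ φ : 𝕂 → ℕ, Monotone φ ∧ (∀ x, φ x ≤ K + 1) ∧
      stepFunction a b α t = cellValue a b α ∘ φ := by
  choose φ h0 h1 h2 using fun x => IsStepMaximal.exists_cell_right (breakPoint t) K x
  refine ⟨φ, ?_, h0, funext fun x => stepFunction_eq a b α ht (h0 x) (h1 x) (h2 x)⟩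
  intro x y hxy
  by_contra! hlt
  have h3 := h2 y (by have := h0 x; omega)
  have h4 := h1 x (by omega)
  have h5 : breakPoint t (φ y) ≤ breakPoint t (φ x - 1) := by
    rcases (show φ y ≤ φ x - 1 by omega).eq_or_lt with he | hlt'
    · rw [he]
    · exact (breakPoint_lt ht hlt' (by have := h0 x; omega)).le
  exact absurd (h3.trans_le (h5.trans (h4.trans hxy))) (lt_irrefl _)

theorem boundedVariationOn_stepFunction (a b : ℂ) (α : Fin K → ℂ) {t : Fin (K + 1) → 𝕂}
    (ht : StrictMono t) : BoundedVariationOn (stepFunction a b α t) Set.univ := by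
  obtain ⟨φ, hφ, hle, he⟩ := exists_cellIndex a b α ht
  rw [he]
  refine ne_top_of_le_ne_top ?_ (eVariationOn.comp_le_of_monotoneOn (cellValue a b α)
    (s := Set.Iic (K + 1)) φ (hφ.monotoneOn _) fun x _ => hle x)
  exact BoundedVariationOn.of_finite _ (Set.Iic (K + 1))

theorem sum_norm_le_eVariationOn [NoMinOrder 𝕂] (a b : ℂ) (α : Fin K → ℂ)
    {t : Fin (K + 1) → 𝕂} (ht : StrictMono t) :
    ENNReal.ofReal (∑ k ∈ Finset.range (K + 1),
      |‖cellValue a b α k‖ - ‖cellValue a b α (k + 1)‖|)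
      ≤ eVariationOn (stepFunction a b α t) Set.univ := by
  obtain ⟨z, hz⟩ := exists_lt (t 0)
  -- One sample per cell: z in the first, and in every other cell its left end, which belongs to it.
  set u : ℕ → 𝕂 := fun n => if n = 0 then z else breakPoint t (n - 1) with hu
  have hz0 : z < breakPoint t 0 := by simpa [breakPoint] using hz
  have hmono : MonotoneOn u (Set.Iic (K + 1)) := by
    intro i hi j hj hij
    simp only [Set.mem_Iic] at hi hj
    simp only [hu]
    split_ifs with h1 h2 h2
    · exact le_rfl
    · rcases Nat.eq_zero_or_pos (j - 1) with h3 | h3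
      · rw [h3]; exact hz0.le
      · exact (hz0.trans (breakPoint_lt ht h3 (by omega))).le
    · omega
    · rcases (show i - 1 ≤ j - 1 by omega).eq_or_lt with he | hlt
      · rw [he]
      · exact (breakPoint_lt ht hlt (by omega)).le
  have hval : ∀ n ≤ K + 1, stepFunction a b α t (u n) = cellValue a b α n := by
    intro n hn
    refine stepFunction_eq a b α ht hn (fun h0 => ?_) fun hK => ?_
    · simp [hu, h0.ne']
    · simp only [hu]
      split_ifs with h0
      · rw [h0]; exact hz0
      · exact breakPoint_lt ht (by omega) hK
  refine le_trans ?_ (eVariationOn.sum_le_of_monotoneOn_Iic (f := stepFunction a b α t)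
    (s := Set.univ) (n := K + 1) hmono fun _ _ => Set.mem_univ _)
  rw [ENNReal.ofReal_sum_of_nonneg fun i _ => abs_nonneg _]
  refine Finset.sum_le_sum fun k hk => ?_
  have hk' : k < K + 1 := Finset.mem_range.1 hk
  rw [hval k (by omega), hval (k + 1) (by omega), edist_dist, dist_comm, dist_eq_norm]
  exact ENNReal.ofReal_le_ofReal (abs_norm_sub_norm_le _ _)

end StepFunction

/-! ### The continuous case -/

section Continuous

variable {K : ℕ}

theorem exists_norm_stepFunction_le {𝕂 : Type*} [LinearOrder 𝕂] (a b : ℂ) (α : Fin K → ℂ)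
    {t : Fin (K + 1) → 𝕂} (ht : StrictMono t) : ∃ C, ∀ x, ‖stepFunction a b α t x‖ ≤ C := by
  obtain ⟨φ, -, hle, he⟩ := exists_cellIndex a b α ht
  obtain ⟨k, -, hmax⟩ := Finset.exists_max_image (Finset.range (K + 2))
    (fun k => ‖cellValue a b α k‖) ⟨0, by simp⟩
  refine ⟨‖cellValue a b α k‖, fun x => ?_⟩
  rw [he]
  exact hmax (φ x) (by have := hle x; simp; omega)

theorem intervalIntegrable_norm_stepFunction (a b : ℂ) (α : Fin K → ℂ) {t : Fin (K + 1) → ℝ}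
    (ht : StrictMono t) (u v : ℝ) :
    IntervalIntegrable (fun y => ‖stepFunction a b α t y‖) volume u v := by
  obtain ⟨C, hC⟩ := exists_norm_stepFunction_le a b α ht
  have hmeas : Measurable (stepFunction a b α t) := by
    unfold stepFunction
    refine ((measurable_const.indicator measurableSet_Iio).add
      (Finset.measurable_sum _ fun k _ => measurable_const.indicator measurableSet_Ico)).add
      (measurable_const.indicator measurableSet_Ici)
  refine (intervalIntegrable_const (c := C)).mono_fun hmeas.norm.aestronglyMeasurable
    (Filter.Eventually.of_forall fun y => ?_)
  simpa only [norm_norm] using (hC y).trans (Real.le_norm_self C)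

theorem isStepMaximal_stepFunction (a b : ℂ) (α : Fin K → ℂ) {t : Fin (K + 1) → ℝ}
    (ht : StrictMono t) :
    IsStepMaximal K (fun k => ‖cellValue a b α k‖) (breakPoint t)
      (fun z => ∫ y in (0 : ℝ)..z, ‖stepFunction a b α t y‖)
      (centeredMaximal (stepFunction a b α t)) := by
  have hint := intervalIntegrable_norm_stepFunction a b α ht
  obtain ⟨C, hC⟩ := exists_norm_stepFunction_le a b α ht
  have hsub : ∀ u v, (∫ y in (0 : ℝ)..v, ‖stepFunction a b α t y‖)
      - ∫ y in (0 : ℝ)..u, ‖stepFunction a b α t y‖ = ∫ y in u..v, ‖stepFunction a b α t y‖ :=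
    fun u v => intervalIntegral.integral_interval_sub_left (hint _ _) (hint _ _)
  refine ⟨fun i j => breakPoint_lt ht, fun k => norm_nonneg _, ?_, ?_, ?_, ?_, ?_⟩
  · intro k hk u v huv h1 h2
    rw [hsub]
    have hcongr : ∫ y in u..v, ‖stepFunction a b α t y‖ = ∫ _y in u..v, ‖cellValue a b α k‖ := by
      rw [intervalIntegral.integral_of_le huv, intervalIntegral.integral_of_le huv,
        integral_Ioc_eq_integral_Ioo, integral_Ioc_eq_integral_Ioo]
      refine setIntegral_congr_fun measurableSet_Ioo fun y hy => ?_
      rw [stepFunction_eq a b α ht hk (fun h0 => (h1 h0).trans hy.1.le)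
        fun hK => hy.2.trans_le (h2 hK)]
    rw [hcongr, intervalIntegral.integral_const, smul_eq_mul, mul_comm]
  · intro u v huv
    have h1 := hsub u v
    have h2 : 0 ≤ ∫ y in u..v, ‖stepFunction a b α t y‖ :=
      intervalIntegral.integral_nonneg huv fun y _ => norm_nonneg _
    dsimp only
    linarith
  · intro B hB x
    rw [centeredMaximal_le_iff hint hC]
    intro r hr
    have h1 : ∀ y, ‖stepFunction a b α t y‖ ≤ B := by
      obtain ⟨φ, -, hle, he⟩ := exists_cellIndex a b α ht
      intro y
      rw [he]
      exact hB _ (hle y)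
    have h2 := setAverage_le hint h1 x hr
    rw [one_div, inv_mul_le_iff₀ (by positivity)] at h2
    linarith
  · intro x r hr
    rw [hsub]
    exact integral_le_centeredMaximal hint hC x hr
  · intro x q hq
    by_contra! hcon
    refine absurd ((centeredMaximal_le_iff hint hC).2 fun r hr => ?_) (not_le.2 hq)
    rw [← hsub]
    exact hcon r hr

theorem eVariationOn_centeredMaximal_le (hK : 1 ≤ K) (a b : ℂ) (α : Fin K → ℂ)
    (hα : ∀ i j : Fin K, (i : ℕ) + 1 = (j : ℕ) → α i * α j = 0) {t : Fin (K + 1) → ℝ}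
    (ht : StrictMono t) :
    eVariationOn (centeredMaximal (stepFunction a b α t)) Set.univ ≤ ENNReal.ofReal
      (∑ k ∈ Finset.range (K + 1), |‖cellValue a b α k‖ - ‖cellValue a b α (k + 1)‖|
        - 1 / 2 * |‖a‖ - ‖b‖|) := by
  have h1 := (isStepMaximal_stepFunction a b α ht).eVariationOn_le hK fun k hk1 hkK => by
    have h2 := hα ⟨k - 1, by omega⟩ ⟨k, hkK⟩ (by simp; omega)
    simp only [norm_eq_zero]
    have e1 : cellValue a b α k = α ⟨k - 1, by omega⟩ := by
      rw [cellValue, if_neg (by omega), dif_pos]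
    have e2 : cellValue a b α (k + 1) = α ⟨k, hkK⟩ := by
      rw [cellValue, if_neg (by omega), dif_pos (by simpa using hkK)]
      rfl
    rw [e1, e2]
    exact mul_eq_zero.1 h2
  have e0 : cellValue a b α 0 = a := by simp [cellValue]
  have e1 : cellValue a b α (K + 1) = b := by simp [cellValue]
  rwa [e0, e1] at h1

end Continuous

/-- A bound for the variation of a real function, transferred to `totalVariation`. -/
theorem totalVariation_conclusion {𝕂 : Type*} [LinearOrder 𝕂] {f : 𝕂 → ℂ} {g : 𝕂 → ℝ} {s d : ℝ}
    (hf : BoundedVariationOn f Set.univ) (hs : ENNReal.ofReal s ≤ eVariationOn f Set.univ)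
    (hg : eVariationOn g Set.univ ≤ ENNReal.ofReal (s - d)) (hd : 0 ≤ s - d) :
    BoundedVariationOn f Set.univ ∧ BoundedVariationOn g Set.univ ∧
      totalVariation g ≤ totalVariation f - d := by
  refine ⟨hf, ne_top_of_le_ne_top ENNReal.ofReal_ne_top hg, ?_⟩
  have h1 : (eVariationOn g Set.univ).toReal ≤ s - d := ENNReal.toReal_le_of_le_ofReal hd hg
  have h2 : s ≤ (eVariationOn f Set.univ).toReal := (ENNReal.ofReal_le_iff_le_toReal hf).1 hs
  unfold totalVariation
  linarith

/-- Needed because `ENNReal.ofReal` truncates negative numbers to 0. -/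
theorem half_abs_le_sum {K : ℕ} (a b : ℂ) (α : Fin K → ℂ) :
    0 ≤ ∑ k ∈ Finset.range (K + 1), |‖cellValue a b α k‖ - ‖cellValue a b α (k + 1)‖|
      - 1 / 2 * |‖a‖ - ‖b‖| := by
  have h1 := dist_le_range_sum_dist (fun k => ‖cellValue a b α k‖) (K + 1)
  have e0 : cellValue a b α 0 = a := by simp [cellValue]
  have e1 : cellValue a b α (K + 1) = b := by simp [cellValue]
  simp only [Real.dist_eq, e0, e1] at h1
  linarith [abs_nonneg (‖a‖ - ‖b‖)]

/-! ### The discrete case by spreading over unit intervals -/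

section Discrete

variable {K : ℕ}

/-- A step function on `ℤ`, spread out to unit intervals centered at the integers. -/
theorem stepFunction_sub_half (a b : ℂ) (α : Fin K → ℂ) (n : Fin (K + 1) → ℤ) (x : ℝ) :
    stepFunction a b α (fun k => (n k : ℝ) - 1 / 2) x = stepFunction a b α n ⌊x + 1 / 2⌋ := by
  have h1 : ∀ k, x < (n k : ℝ) - 1 / 2 ↔ ⌊x + 1 / 2⌋ < n k := fun k => by
    rw [Int.floor_lt, lt_sub_iff_add_lt]
  have h2 : ∀ k, (n k : ℝ) - 1 / 2 ≤ x ↔ n k ≤ ⌊x + 1 / 2⌋ := fun k => by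
    rw [Int.le_floor, sub_le_iff_le_add]
  simp only [stepFunction, Set.indicator_apply, Set.mem_Iio, Set.mem_Ico, Set.mem_Ici, h1, h2]

theorem integral_unit {f : ℝ → ℂ} {F : ℤ → ℂ} (hf : ∀ x, f x = F ⌊x + 1 / 2⌋) (y : ℤ) {u v : ℝ}
    (huv : u ≤ v) (hu : (y : ℝ) - 1 / 2 ≤ u) (hv : v ≤ y + 1 / 2) :
    ∫ z in u..v, ‖f z‖ = ‖F y‖ * (v - u) := by
  have hcongr : ∫ z in u..v, ‖f z‖ = ∫ _z in u..v, ‖F y‖ :=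
    intervalIntegral.integral_congr_Ioo_of_le huv fun z hz => by
      have hfl : ⌊z + 1 / 2⌋ = y := by
        rw [Int.floor_eq_iff]
        constructor <;> linarith [hz.1, hz.2]
      simp only [hf, hfl]
  rw [hcongr, intervalIntegral.integral_const, smul_eq_mul, mul_comm]

/-- The integral is affine in the radius between consecutive half-integers, so radii j + 1/2
determine the supremum at an integer. -/
theorem integral_enlarge {f : ℝ → ℂ} {F : ℤ → ℂ} (hf : ∀ x, f x = F ⌊x + 1 / 2⌋)
    (hint : ∀ a b, IntervalIntegrable (fun y => ‖f y‖) volume a b) (n : ℤ) (j : ℕ) {s : ℝ}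
    (hs0 : 0 ≤ s) (hs1 : s ≤ 1) :
    ∫ z in ((n : ℝ) - (j + 1 / 2 + s))..(n + (j + 1 / 2 + s)), ‖f z‖
      = (∫ z in ((n : ℝ) - (j + 1 / 2))..(n + (j + 1 / 2)), ‖f z‖)
        + s * (‖F (n - j - 1)‖ + ‖F (n + j + 1)‖) := by
  have h1 := integral_unit hf (n - j - 1) (u := n - (j + 1 / 2 + s)) (v := n - (j + 1 / 2))
    (by linarith) (by push_cast; linarith) (by push_cast; linarith)
  have h2 := integral_unit hf (n + j + 1) (u := n + (j + 1 / 2)) (v := n + (j + 1 / 2 + s))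
    (by linarith) (by push_cast; linarith) (by push_cast; linarith)
  rw [← intervalIntegral.integral_add_adjacent_intervals (hint _ (n - (j + 1 / 2))) (hint _ _),
    ← intervalIntegral.integral_add_adjacent_intervals (hint (n - (j + 1 / 2)) (n + (j + 1 / 2)))
      (hint _ _), h1, h2]
  ring

theorem sum_Icc_enlarge (G : ℤ → ℝ) (n : ℤ) (j : ℕ) :
    ∑ y ∈ Finset.Icc (n - ((j + 1 : ℕ) : ℤ)) (n + ((j + 1 : ℕ) : ℤ)), G y
      = ∑ y ∈ Finset.Icc (n - (j : ℤ)) (n + (j : ℤ)), G y + (G (n - j - 1) + G (n + j + 1)) := by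
  have hset : Finset.Icc (n - ((j + 1 : ℕ) : ℤ)) (n + ((j + 1 : ℕ) : ℤ))
      = insert (n - j - 1) (insert (n + j + 1) (Finset.Icc (n - (j : ℤ)) (n + (j : ℤ)))) := by
    ext y
    simp only [Finset.mem_Icc, Finset.mem_insert]
    push_cast
    omega
  rw [hset, Finset.sum_insert, Finset.sum_insert]
  · ring
  · simp only [Finset.mem_Icc]; omega
  · simp only [Finset.mem_insert, Finset.mem_Icc]; omega

theorem integral_eq_sum_Icc {f : ℝ → ℂ} {F : ℤ → ℂ} (hf : ∀ x, f x = F ⌊x + 1 / 2⌋)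
    (hint : ∀ a b, IntervalIntegrable (fun y => ‖f y‖) volume a b) (n : ℤ) (j : ℕ) :
    ∫ z in ((n : ℝ) - (j + 1 / 2))..(n + (j + 1 / 2)), ‖f z‖
      = ∑ y ∈ Finset.Icc (n - (j : ℤ)) (n + (j : ℤ)), ‖F y‖ := by
  induction j with
  | zero =>
    rw [integral_unit hf n (by linarith) (by simp) (by simp)]
    simp
    norm_num
  | succ j ih =>
    have h1 := integral_enlarge hf hint n j zero_le_one le_rfl
    rw [sum_Icc_enlarge (fun y => ‖F y‖), ← ih]
    push_cast
    rw [show (j : ℝ) + 1 + 1 / 2 = j + 1 / 2 + 1 by ring, h1]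
    ring

/-- The discrete maximal function is the restriction of a continuous one. -/
theorem discreteCenteredMaximal_eq {f : ℝ → ℂ} {F : ℤ → ℂ} (hf : ∀ x, f x = F ⌊x + 1 / 2⌋)
    (hint : ∀ a b, IntervalIntegrable (fun y => ‖f y‖) volume a b) {C : ℝ}
    (hC : ∀ y, ‖f y‖ ≤ C) (n : ℤ) :
    discreteCenteredMaximal F n = centeredMaximal f n := by
  have hterm : ∀ j : ℕ, (1 / (2 * (j : ℝ) + 1)) *
      ∑ y ∈ Finset.Icc (n - (j : ℤ)) (n + (j : ℤ)), ‖F y‖ ≤ centeredMaximal f n := by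
    intro j
    have h1 := integral_le_centeredMaximal hint hC n (r := j + 1 / 2) (by positivity)
    rw [integral_eq_sum_Icc hf hint] at h1
    rw [one_div, inv_mul_le_iff₀ (by positivity)]
    linarith
  have hbdd : BddAbove (Set.range fun j : ℕ => (1 / (2 * (j : ℝ) + 1)) *
      ∑ y ∈ Finset.Icc (n - (j : ℤ)) (n + (j : ℤ)), ‖F y‖) := by
    refine ⟨centeredMaximal f n, ?_⟩
    rintro _ ⟨j, rfl⟩
    exact hterm j
  have hsum : ∀ j : ℕ, ∑ y ∈ Finset.Icc (n - (j : ℤ)) (n + (j : ℤ)), ‖F y‖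
      ≤ discreteCenteredMaximal F n * (2 * j + 1) := by
    intro j
    have h1 := le_ciSup hbdd j
    rw [one_div, inv_mul_le_iff₀ (by positivity), mul_comm] at h1
    exact h1
  refine le_antisymm (ciSup_le hterm) ((centeredMaximal_le_iff hint hC).2 fun r hr => ?_)
  rcases le_or_gt r (1 / 2) with hr2 | hr2
  · rw [integral_unit hf n (by linarith) (by linarith) (by linarith)]
    have h1 := hsum 0
    simp only [Nat.cast_zero, sub_zero, add_zero, Finset.Icc_self, Finset.sum_singleton,
      mul_zero, zero_add, mul_one] at h1
    have := mul_le_mul_of_nonneg_right h1 (show (0 : ℝ) ≤ 2 * r by linarith)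
    linarith
  · obtain ⟨j, s, hs0, hs1, rfl⟩ : ∃ (j : ℕ) (s : ℝ), 0 ≤ s ∧ s ≤ 1 ∧ r = j + 1 / 2 + s := by
      have h0 : 0 ≤ r - 1 / 2 := by linarith
      refine ⟨⌊r - 1 / 2⌋₊, r - 1 / 2 - ⌊r - 1 / 2⌋₊, ?_, ?_, by ring⟩
      · linarith [Nat.floor_le h0]
      · linarith [Nat.lt_floor_add_one (r - 1 / 2)]
    rw [integral_enlarge hf hint n j hs0 hs1, integral_eq_sum_Icc hf hint]
    have h1 := hsum j
    have h2 := hsum (j + 1)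
    rw [sum_Icc_enlarge (fun y => ‖F y‖)] at h2
    push_cast at h2
    -- Weights 1 - s and s combine the lengths 2j + 1 and 2j + 3 to 2j + 1 + 2s, which is 2r.
    have h3 := mul_le_mul_of_nonneg_left h1 (show 0 ≤ 1 - s by linarith)
    have h4 := mul_le_mul_of_nonneg_left h2 hs0
    linarith

end Discrete

theorem theorem1 (K : ℕ) (hK : 1 ≤ K) (a b : ℂ) (α : Fin K → ℂ)
    (hα : ∀ i j : Fin K, (i : ℕ) + 1 = (j : ℕ) → α i * α j = 0) :
    (∀ t : Fin (K + 1) → ℝ, StrictMono t →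
      BoundedVariationOn (stepFunction a b α t) Set.univ ∧
      BoundedVariationOn (centeredMaximal (stepFunction a b α t)) Set.univ ∧
      totalVariation (centeredMaximal (stepFunction a b α t)) ≤
        totalVariation (stepFunction a b α t) - (1 / 2) * |‖a‖ - ‖b‖|) ∧
    (∀ n : Fin (K + 1) → ℤ, StrictMono n →
      BoundedVariationOn (stepFunction a b α n) Set.univ ∧
      BoundedVariationOn (discreteCenteredMaximal (stepFunction a b α n)) Set.univ ∧
      totalVariation (discreteCenteredMaximal (stepFunction a b α n)) ≤
        totalVariation (stepFunction a b α n) - (1 / 2) * |‖a‖ - ‖b‖|) := by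
  refine ⟨fun t ht => ?_, fun n hn => ?_⟩
  · exact totalVariation_conclusion (boundedVariationOn_stepFunction a b α ht)
      (sum_norm_le_eVariationOn a b α ht) (eVariationOn_centeredMaximal_le hK a b α hα ht)
      (half_abs_le_sum a b α)
  · have ht : StrictMono fun k => (n k : ℝ) - 1 / 2 := fun i j hij => by
      have : (n i : ℝ) < n j := by exact_mod_cast hn hij
      simpa using this
    obtain ⟨C, hC⟩ := exists_norm_stepFunction_le a b α ht
    have heq : discreteCenteredMaximal (stepFunction a b α n) =
        centeredMaximal (stepFunction a b α fun k => (n k : ℝ) - 1 / 2) ∘ (fun m : ℤ => (m : ℝ)) :=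
      funext fun m => discreteCenteredMaximal_eq (stepFunction_sub_half a b α n)
        (intervalIntegrable_norm_stepFunction a b α ht) hC m
    refine totalVariation_conclusion (boundedVariationOn_stepFunction a b α hn)
      (sum_norm_le_eVariationOn a b α hn) ?_ (half_abs_le_sum a b α)
    -- Sampling at the integers cannot increase the variation, and the continuous bound involves
    -- only the heights.
    rw [heq]
    exact (eVariationOn.comp_le_of_monotoneOn _ (fun m : ℤ => (m : ℝ))
      (Int.cast_mono.monotoneOn _) (Set.mapsTo_univ _ _)).trans
      (eVariationOn_centeredMaximal_le hK a b α hα ht)
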